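/- Let $X$ be a CAT(0) space (not necessarily complete or proper), and let $d$ be its metric. A \emph{curtain} is a set $h=\pi_\alpha^{-1}([r-\tfrac12,r+\tfrac12])$, where $\alpha:I\to X$ is a geodesic defined on a closed interval $I\subseteq\mathbb R$, $\pi_\alpha$ is the closest point projection to $\alpha$, and $[r-\tfrac12,r+\tfrac12]$ lies in the interior of $I$; its half spaces are $h^-=\pi_\alpha^{-1}\big((-\infty,r-\tfrac12)\big)$ and $h^+=\pi_\alpha^{-1}\big((r+\tfrac12,\infty)\big)$, and $h$ separates $A$ from $B$ if one of these sets lies in $h^-$ and the other in $h^+$. A \emph{chain} is a sequence of curtains $(h_i)$ in which consecutive curtains are disjoint and each $h_i$ separates $h_{i-1}$ from $h_{i+1}$; its cardinality is the number of its curtains. Two disjoint curtains $h,h'$ are \emph{$L$-separated} if every chain all of whose elements meet both $h$ and $h'$ has cardinality at most $L$, and an \emph{$L$-chain} is a chain whose elements are pairwise $L$-separated. For $L\in\{1,2,\dots\}$ let $X_L=(X,d_L)$, where $d_L(x,x)=0$ and, for $x\ne y$, $d_L(x,y)=1+\max\{|c| : c \text{ an } L\text{-chain each of whose elements separates } x \text{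 from } y\}$. Fix $\lambda_L\in(0,1)$, $L=1,2,\dots$, with $\sum_{L\ge1}\lambda_L=1$ and $\sum_{L\ge1}L^2\lambda_L<\infty$, and let $X_D=(X,D)$ with $D(x,y)=\sum_{L\ge1}\lambda_L d_L(x,y)$ be the corresponding \emph{curtain model}. For an isometry $g$ of $X$ and a metric $\rho\in\{d,d_L,D\}$ let $\tau_\rho(g)=\lim_{n\to\infty}\rho(x,g^nx)/n$ (independent of $x$). Call $g$ \emph{semisimple} if $d(x,gx)=\tau_d(g)$ for some $x\in X$. For $\rho\in\{d_L,D\}$, call $g$ \emph{loxodromic} on $(X,\rho)$ if $\tau_\rho(g)>0$, \emph{elliptic} if the orbits of $\langle g\rangle$ are $\rho$-bounded, and \emph{parabolic} if $\tau_\rho(g)=0$ and the orbits of $\langle g\rangle$ are $\rho$-unbounded. Call $g$ \emph{contracting} if for some $x\in X$ the map $n\mapsto g^nx$ is a quasi-isometric embedding of $\mathbb Z$ into $X$ and there is a constant $C$ such that, for every open ball $B$ disjoint from the orbit $A=\{g^nx:n\in\mathbb Z\}$, the set of all points of $A$ that are closest to some point of $B$ has diameter at most $C$. \textbf{Theorem.}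 Let $g$ be a semisimple isometry of the CAT(0) space $X$. The following are equivalent: (1) $g$ is contracting; (2) $g$ is loxodromic on $X_L$ for some $L\ge1$; (3) $g$ is loxodromic on $X_D$. Moreover, $g$ is not parabolic on $X_D$: it is loxodromic on $X_D$ if and only if it is contracting, and it is elliptic on $X_D$ otherwise. -/

import Mathlib

open Filter Topology

namespace CurtainModel

/-- A CAT(0) space: a geodesic metric space all of whose geodesic triangles are no fatter than
their Euclidean comparison triangles. The points `x` and `y` lie on geodesics from `p` to `q` and
from `p` to `r` (in a geodesic space, `x` lies on some geodesic from `p` to `q` exactly when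
`dist p x + dist x q = dist p q`), and `x'`, `y'` are the corresponding comparison points; any two
sides of a triangle have a vertex `p` in common. -/
structure IsCAT0 (X : Type*) [MetricSpace X] : Prop where
  exists_geodesic : ∀ x y : X, ∃ γ : ℝ → X, γ 0 = x ∧ γ (dist x y) = y ∧
    ∀ s ∈ Set.Icc 0 (dist x y), ∀ t ∈ Set.Icc 0 (dist x y), dist (γ s) (γ t) = |s - t|
  comparison : ∀ p q r x y : X,
    dist p x + dist x q = dist p q → dist p y + dist y r = dist p r →
    ∀ p' q' r' x' y' : EuclideanSpace ℝ (Fin 2),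
      dist p' q' = dist p q → dist q' r' = dist q r → dist p' r' = dist p r →
      dist p' x' = dist p x → dist x' q' = dist x q →
      dist p' y' = dist p y → dist y' r' = dist y r →
      dist x y ≤ dist x' y'

section Spaces

variable {X : Type*} [MetricSpace X]

/-- The set-valued closest point projection of `x` to `A`. -/
def closestPoints (A : Set X) (x : X) : Set X :=
  {a | a ∈ A ∧ ∀ b ∈ A, dist x a ≤ dist x b}

/-- The data of a curtain: a geodesic `α : I → X` defined on a closed interval `I` of the real
line (bounded or not; the values of `α` outside `I` play no role), and a number `r` such that the
pole `[r - 1/2, r + 1/2]` lies in the interior of `I`. -/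
structure Curtain (X : Type*) [MetricSpace X] where
  I : Set ℝ
  α : ℝ → X
  r : ℝ
  ordConnected : I.OrdConnected
  isClosed : IsClosed I
  isGeodesic : ∀ s ∈ I, ∀ t ∈ I, dist (α s) (α t) = |s - t|
  pole_subset : Set.Icc (r - 1 / 2) (r + 1 / 2) ⊆ interior I

namespace Curtain

/-- The preimage, under the closest point projection to the geodesic, of the part of the geodesic
whose parameters lie in `S`. -/
def projPreimage (h : Curtain X) (S : Set ℝ) : Set X :=
  {x | ∃ t ∈ h.I ∩ S, h.α t ∈ closestPoints (h.α '' h.I) x}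

/-- The curtain as a subset of the space. -/
def carrier (h : Curtain X) : Set X :=
  h.projPreimage (Set.Icc (h.r - 1 / 2) (h.r + 1 / 2))

/-- The half space `h⁻`. -/
def minus (h : Curtain X) : Set X := h.projPreimage (Set.Iio (h.r - 1 / 2))

/-- The half space `h⁺`. -/
def plus (h : Curtain X) : Set X := h.projPreimage (Set.Ioi (h.r + 1 / 2))

/-- The curtain `h` separates the sets `A` and `B`. -/
def Separates (h : Curtain X) (A B : Set X) : Prop :=
  (A ⊆ h.minus ∧ B ⊆ h.plus) ∨ (A ⊆ h.plus ∧ B ⊆ h.minus)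

end Curtain

/-- A chain of `n` curtains: each curtain separates its predecessor from its successor. The
disjointness of consecutive curtains follows from this when `n ≥ 3`; for `n = 2` it is the
convention under which `⌈d(x, y)⌉ - 1` is the largest cardinality of a chain separating the
distinct points `x` and `y`. -/
def IsChain {n : ℕ} (c : Fin n → Curtain X) : Prop :=
  (∀ i j : Fin n, (i : ℕ) + 1 = j → Disjoint (c i).carrier (c j).carrier) ∧
  ∀ i j k : Fin n, (i : ℕ) + 1 = j → (j : ℕ) + 1 = k →
    (c j).Separates (c i).carrier (c k).carrier

/-- Two disjoint curtains are `L`-separated if every chain all of whose elements meet both of them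
has cardinality at most `L`. -/
def LSeparated (L : ℕ) (h k : Curtain X) : Prop :=
  Disjoint h.carrier k.carrier ∧
  ∀ (n : ℕ) (c : Fin n → Curtain X), IsChain c →
    (∀ i, ((c i).carrier ∩ h.carrier).Nonempty ∧ ((c i).carrier ∩ k.carrier).Nonempty) → n ≤ L

/-- An `L`-chain: a chain whose elements are pairwise `L`-separated. -/
def IsLChain (L : ℕ) {n : ℕ} (c : Fin n → Curtain X) : Prop :=
  IsChain c ∧ ∀ i j : Fin n, i ≠ j → LSeparated L (c i) (c j)

open Classical in
/-- The metric `d_L` of the space `X_L`: one plus the largest cardinality of an `L`-chain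
separating `x` from `y`, and `0` if `x = y`. In a CAT(0) space the half spaces of a curtain are at
distance `1`, so these cardinalities are bounded by `dist x y`; the empty chain is one of them. -/
noncomputable def distL (L : ℕ) (x y : X) : ℝ :=
  if x = y then 0 else
    1 + ((sSup {n : ℕ | ∃ c : Fin n → Curtain X,
      IsLChain L c ∧ ∀ i, (c i).Separates {x} {y}} : ℕ) : ℝ)

/-- The weights `λ_L ∈ (0, 1)`, `L = 1, 2, …`, used to build a curtain model. -/
structure IsCurtainWeight (w : ℕ+ → ℝ) : Prop where
  mem_Ioo : ∀ L, w L ∈ Set.Ioo (0 : ℝ) 1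
  hasSum_one : HasSum w 1
  summable_sq : Summable fun L : ℕ+ => ((L : ℕ) : ℝ) ^ 2 * w L

/-- The metric `D` of the curtain model `X_D` with weights `w`. The series converges in a CAT(0)
space, because `d_L` is bounded by `1 + dist x y`. -/
noncomputable def distD (w : ℕ+ → ℝ) (x y : X) : ℝ :=
  ∑' L : ℕ+, w L * distL (L : ℕ) x y

/-- The number `t` is the translation length of `g` for the distance function `d`. -/
def IsTranslationLength (d : X → X → ℝ) (g : X ≃ᵢ X) (t : ℝ) : Prop :=
  ∀ x, Tendsto (fun n : ℕ => d x ((g ^ n) x) / n) atTop (𝓝 t)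

/-- The isometry `g` is semisimple: its minimal set is not empty. -/
def IsSemisimple (g : X ≃ᵢ X) : Prop :=
  ∃ t : ℝ, IsTranslationLength dist g t ∧ ∃ x, dist x (g x) = t

/-- The orbit of `x` under the group generated by `g` is bounded for the distance function `d`. -/
def OrbitBounded (d : X → X → ℝ) (g : X ≃ᵢ X) (x : X) : Prop :=
  ∃ R : ℝ, ∀ m n : ℤ, d ((g ^ m) x) ((g ^ n) x) ≤ R

/-- `g` is elliptic on `(X, d)`. -/
def IsElliptic (d : X → X → ℝ) (g : X ≃ᵢ X) : Prop := ∀ x, OrbitBounded d g x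

/-- `g` is parabolic on `(X, d)`. -/
def IsParabolic (d : X → X → ℝ) (g : X ≃ᵢ X) : Prop :=
  IsTranslationLength d g 0 ∧ ∃ x, ¬ OrbitBounded d g x

/-- `g` is loxodromic on `(X, d)`. -/
def IsLoxodromic (d : X → X → ℝ) (g : X ≃ᵢ X) : Prop :=
  ∃ t : ℝ, 0 < t ∧ IsTranslationLength d g t

/-- A set `A` is `C`-contracting: the closest point projection to `A` of every open ball disjoint
from `A` has diameter at most `C`. -/
def IsContractingSet (C : ℝ) (A : Set X) : Prop :=
  ∀ (z : X) (ρ : ℝ), Disjoint (Metric.ball z ρ) A →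
    ∀ b ∈ Metric.ball z ρ, ∀ b' ∈ Metric.ball z ρ,
      ∀ a ∈ closestPoints A b, ∀ a' ∈ closestPoints A b', dist a a' ≤ C

/-- A quasi-isometric embedding of the integers. -/
def IsQIEmbedding (f : ℤ → X) : Prop :=
  ∃ K c : ℝ, 1 ≤ K ∧ 0 ≤ c ∧ ∀ m n : ℤ,
    |(m : ℝ) - n| / K - c ≤ dist (f m) (f n) ∧ dist (f m) (f n) ≤ K * |(m : ℝ) - n| + c

/-- A contracting isometry. -/
def IsContracting (g : X ≃ᵢ X) : Prop :=
  ∃ x : X, IsQIEmbedding (fun n : ℤ => (g ^ n) x) ∧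
    ∃ C : ℝ, IsContractingSet C (Set.range fun n : ℤ => (g ^ n) x)

end Spaces

end CurtainModel

/-!
All the geometry rests on Stewart's inequality `IsCAT0.stewart`. It makes the closest point
projection to a geodesic well defined and `1`-Lipschitz, with connected preimages of intervals, so
a curtain is the slab `|coord| ≤ 1/2` of a `1`-Lipschitz function `Curtain.coord`, and it is
connected. Disjoint curtains are therefore nested, every chain can be directed consistently
(`IsChain.exists_ordered`), and `d_L` and `D` are metrics invariant under isometries, whose
translation lengths exist by subadditivity.

A semisimple isometry `g` of positive translation length translates an axis `β`
(`exists_isAxis`). The notion that connects contraction with curtains is that of an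
`L`-*bottleneck* of `β` (`Geodesic.IsBottleneck`): a bounded piece of `β` such that at most `L`
members of a chain of curtains can reach across it, in terms of the projection to `β`.

* If an orbit of `g` is contracting, then `β` is contracting, and a curtain that reaches across a
  long piece of `β` must pass near this piece. The members of a chain that meet a bounded set are
  bounded in number, so `β` has bottlenecks (`Geodesic.IsContracting.exists_isBottleneck`). Widely
  spaced curtains dual to `β` then form `L`-chains, and `g` is loxodromic on `X_L`
  (`IsAxis.isLoxodromic_distL`), hence on the curtain model, because `D ≥ λ_L d_L`.

* Conversely, suppose that for some `L` an `L`-chain with at least `2 L + 10` members separates two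
  points of `β`. Two `L`-separated curtains cannot both cross a piece of a geodesic that is longer
  than `L + 1`, because they would both meet the curtains dual to that piece
  (`LSeparated.width_le`). This bounds how often `β` can return to members of the chain and keeps
  points with distant projections on the correct sides of its middle members, so that `β` has an
  `L`-bottleneck (`IsLChainFromTo.isBottleneck`), and by translation bottlenecks everywhere. The
  same argument, applied to a perpendicular of `β`, shows that geodesics with a large projection to
  `β` pass near `β` (`Geodesic.dist_le_of_isBottleneck`), and `g` is contracting
  (`IsAxis.isContracting`).

If `g` is not contracting, it follows that `d_L ≤ 2 L + 10` on the axis for all `L`. These bounds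
are summable against the weights, so `g` has a bounded orbit in the curtain model and is elliptic
there. All claims of the theorem follow from these implications.
-/

namespace CurtainModel

variable {X : Type*} [MetricSpace X]

/-! ### Comparison inequalities -/

/-- Stewart's theorem in the Euclidean plane, for the triangle with vertices `(0, 0)`, `(c, 0)` and
an apex at distances `A` and `B` from them: it provides the comparison triangle and the comparison
point that divides the base in the ratio `θ : 1 - θ`. -/
theorem exists_comparison_triangle {A B c θ : ℝ} (hA : 0 ≤ A) (hB : 0 ≤ B) (hc : 0 < c)
    (h₁ : A ≤ B + c) (h₂ : B ≤ A + c) (h₃ : c ≤ A + B) (hθ₀ : 0 ≤ θ) (hθ₁ : θ ≤ 1) :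
    ∃ a b x m : EuclideanSpace ℝ (Fin 2), dist a b = c ∧ dist b x = B ∧ dist a x = A ∧
      dist a m = θ * c ∧ dist m b = (1 - θ) * c ∧
      dist m x ^ 2 = (1 - θ) * A ^ 2 + θ * B ^ 2 - θ * (1 - θ) * c ^ 2 := by
  obtain ⟨u, hu⟩ : ∃ u : ℝ, 2 * c * u = c ^ 2 + A ^ 2 - B ^ 2 :=
    ⟨(c ^ 2 + A ^ 2 - B ^ 2) / (2 * c), by field_simp⟩
  have hu2 : u ^ 2 ≤ A ^ 2 := by
    apply sq_le_sq'
    · have : 0 ≤ 2 * c * (u + A) := by nlinarith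
      have := nonneg_of_mul_nonneg_right this (by positivity)
      linarith
    · have : 0 ≤ 2 * c * (A - u) := by nlinarith
      have := nonneg_of_mul_nonneg_right this (by positivity)
      linarith
  have hv : √(A ^ 2 - u ^ 2) ^ 2 = A ^ 2 - u ^ 2 := Real.sq_sqrt (by linarith)
  set v := √(A ^ 2 - u ^ 2) with hvdef
  have key : ∀ {r s : ℝ}, 0 ≤ s → r = s ^ 2 → √r = s := by
    intro r s hs h; rw [h, Real.sqrt_sq hs]
  refine ⟨!₂[0, 0], !₂[c, 0], !₂[u, v], !₂[θ * c, 0], ?_, ?_, ?_, ?_, ?_, ?_⟩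
  · rw [EuclideanSpace.dist_eq]; apply key hc.le
    simp [Fin.sum_univ_two, Real.dist_eq, sq_abs]
  · rw [EuclideanSpace.dist_eq]; apply key hB
    simp [Fin.sum_univ_two, Real.dist_eq, sq_abs]; nlinarith
  · rw [EuclideanSpace.dist_eq]; apply key hA
    simp [Fin.sum_univ_two, Real.dist_eq, sq_abs]; nlinarith
  · rw [EuclideanSpace.dist_eq]; apply key (by positivity)
    simp [Fin.sum_univ_two, Real.dist_eq, sq_abs]
  · rw [EuclideanSpace.dist_eq]; apply key (mul_nonneg (by linarith) hc.le)
    simp [Fin.sum_univ_two, Real.dist_eq, sq_abs]; ring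
  · rw [EuclideanSpace.dist_eq, Real.sq_sqrt (by positivity)]
    simp [Fin.sum_univ_two, Real.dist_eq, sq_abs]
    linear_combination hv - θ * hu

namespace IsCAT0

/-- Stewart's inequality (the CN inequality with arbitrary weights). All the CAT(0) geometry
below is derived from it. -/
theorem stewart (hX : IsCAT0 X) {a b m : X} (x : X) {θ : ℝ} (hθ₀ : 0 ≤ θ) (hθ₁ : θ ≤ 1)
    (ham : dist a m = θ * dist a b) (hmb : dist m b = (1 - θ) * dist a b) :
    dist x m ^ 2 ≤
      (1 - θ) * dist x a ^ 2 + θ * dist x b ^ 2 - θ * (1 - θ) * dist a b ^ 2 := by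
  rcases eq_or_ne a b with rfl | hab
  · have : a = m := by simpa using ham
    subst this; simp; nlinarith
  · obtain ⟨a', b', x', m', h1, h2, h3, h4, h5, h6⟩ :=
      exists_comparison_triangle (A := dist a x) (B := dist b x) (c := dist a b) dist_nonneg
        dist_nonneg (dist_pos.2 hab) (by linarith [dist_triangle a b x])
        (by linarith [dist_triangle b a x, dist_comm a b])
        (by linarith [dist_triangle a x b, dist_comm x b]) hθ₀ hθ₁
    have := hX.comparison a b x m x (by rw [ham, hmb]; ring) (by simp) a' b' x' m' x' h1 h2 h3
      (by rw [h4, ham]) (by rw [h5, hmb]) h3 (by simp)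
    rw [dist_comm x m, dist_comm x a, dist_comm x b, ← h6]
    gcongr

/-- The sum of the squares of the diagonals of a quadrilateral is at most the sum of the squares
of its sides. -/
theorem quadrilateral (hX : IsCAT0 X) (a b c d : X) :
    dist a c ^ 2 + dist b d ^ 2 ≤
      dist a b ^ 2 + dist b c ^ 2 + dist c d ^ 2 + dist d a ^ 2 := by
  obtain ⟨γ, h0, h1, hγ⟩ := hX.exists_geodesic b d
  have hd : 0 ≤ dist b d := dist_nonneg
  have e1 := hγ 0 ⟨le_rfl, hd⟩ (dist b d / 2) ⟨by linarith, by linarith⟩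
  have e2 := hγ (dist b d / 2) ⟨by linarith, by linarith⟩ _ ⟨hd, le_rfl⟩
  rw [h0, abs_of_nonpos (by linarith),
    show -(0 - dist b d / 2) = 1 / 2 * dist b d by ring] at e1
  rw [h1, abs_of_nonpos (by linarith),
    show -(dist b d / 2 - dist b d) = (1 - 1 / 2) * dist b d by ring] at e2
  have s1 := hX.stewart a (by norm_num) (by norm_num) e1 e2
  have s2 := hX.stewart c (by norm_num) (by norm_num) e1 e2
  have t := dist_triangle a (γ (dist b d / 2)) c
  rw [dist_comm (γ _) c] at t
  rw [dist_comm c b] at s2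
  rw [dist_comm d a]
  have := dist_nonneg (x := a) (y := c)
  nlinarith [sq_nonneg (dist a (γ (dist b d / 2)) - dist c (γ (dist b d / 2)))]

end IsCAT0

/-! ### Metric intervals -/

/-- The metric interval between `x` and `y`: in a CAT(0) space, the geodesic from `x` to `y`. -/
def between (x y : X) : Set X := {z | dist x z + dist z y = dist x y}

theorem mem_between {x y z : X} : z ∈ between x y ↔ dist x z + dist z y = dist x y := Iff.rfl

theorem left_mem_between (x y : X) : x ∈ between x y := by simp [between]

theorem right_mem_between (x y : X) : y ∈ between x y := by simp [between]

theorem between_comm (x y : X) : between x y = between y x := by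
  ext z; rw [mem_between, mem_between, dist_comm x z, dist_comm z y, dist_comm x y, add_comm]

theorem between_subset_left {x y z : X} (h : z ∈ between x y) : between x z ⊆ between x y := by
  intro w hw
  rw [mem_between] at *
  linarith [dist_triangle w z y, dist_triangle x w y]

theorem IsCAT0.isPreconnected_between (hX : IsCAT0 X) (x y : X) :
    IsPreconnected (between x y) := by
  refine isPreconnected_of_forall x fun z hz => ?_
  obtain ⟨γ, h0, h1, hγ⟩ := hX.exists_geodesic x z
  have hd : 0 ≤ dist x z := dist_nonneg
  refine ⟨γ '' Set.Icc 0 (dist x z), ?_, ⟨0, ⟨le_rfl, hd⟩, h0⟩, ⟨_, ⟨hd, le_rfl⟩, h1⟩, ?_⟩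
  · rintro _ ⟨t, ht, rfl⟩
    apply between_subset_left hz
    have e1 := hγ 0 ⟨le_rfl, hd⟩ t ht
    have e2 := hγ t ht _ ⟨hd, le_rfl⟩
    rw [h0] at e1; rw [h1] at e2
    rw [mem_between]
    rw [e1, e2, abs_of_nonpos (by linarith [ht.1]), abs_of_nonpos (by linarith [ht.2])]; ring
  · refine isPreconnected_Icc.image _ ?_
    refine (LipschitzOnWith.of_dist_le_mul (K := 1) fun s hs t ht => ?_).continuousOn
    rw [hγ s hs t ht, Real.dist_eq]; simp

theorem IsCAT0.exists_mem_between (hX : IsCAT0 X) {f : X → ℝ} (hf : Continuous f) {x y : X} {c : ℝ}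
    (hx : f x ≤ c) (hy : c ≤ f y) : ∃ z ∈ between x y, f z = c := by
  obtain ⟨z, hz, rfl⟩ := (hX.isPreconnected_between x y).intermediate_value
    (left_mem_between x y) (right_mem_between x y) hf.continuousOn ⟨hx, hy⟩
  exact ⟨z, hz, rfl⟩

/-! ### Projection to a geodesic -/

/-- A geodesic of `X`, defined on a closed interval `I` (the values of `α` outside `I` are
irrelevant). -/
structure Geodesic (X : Type*) [MetricSpace X] where
  I : Set ℝ
  α : ℝ → X
  nonempty : I.Nonempty
  ordConnected : I.OrdConnected
  isClosed : IsClosed I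
  isGeodesic : ∀ s ∈ I, ∀ t ∈ I, dist (α s) (α t) = |s - t|

namespace Geodesic

variable (β : Geodesic X)

theorem continuousOn : ContinuousOn β.α β.I := by
  refine (LipschitzOnWith.of_dist_le_mul (K := 1) fun s hs t ht => ?_).continuousOn
  rw [β.isGeodesic s hs t ht, Real.dist_eq]; simp

theorem exists_closest (x : X) :
    ∃ t ∈ β.I, ∀ s ∈ β.I, dist x (β.α t) ≤ dist x (β.α s) := by
  obtain ⟨t₀, ht₀⟩ := β.nonempty
  set D := dist x (β.α t₀)
  have hD : 0 ≤ D := dist_nonneg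
  have hc : IsCompact (β.I ∩ Set.Icc (t₀ - 2 * D) (t₀ + 2 * D)) :=
    isCompact_Icc.inter_left β.isClosed
  have hcont : ContinuousOn (fun t => dist x (β.α t)) β.I :=
    Continuous.comp_continuousOn (continuous_const.dist continuous_id) β.continuousOn
  obtain ⟨t, ht, hmin⟩ := hc.exists_isMinOn ⟨t₀, ht₀, by constructor <;> linarith⟩
    (hcont.mono Set.inter_subset_left)
  refine ⟨t, ht.1, fun s hs => ?_⟩
  by_cases h : s ∈ Set.Icc (t₀ - 2 * D) (t₀ + 2 * D)
  · exact hmin ⟨hs, h⟩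
  · have h1 : dist x (β.α t) ≤ D := hmin ⟨ht₀, by constructor <;> linarith⟩
    have h2 := β.isGeodesic s hs t₀ ht₀
    have h3 := dist_triangle (β.α s) x (β.α t₀)
    rw [dist_comm _ x] at h3
    have h4 : 2 * D < |s - t₀| := by
      by_contra! h'
      exact h ⟨by linarith [(abs_le.1 h').1], by linarith [(abs_le.1 h').2]⟩
    linarith

/-- The parameter of the closest point projection of `x` to the geodesic. -/
noncomputable def param (x : X) : ℝ := (β.exists_closest x).choose

theorem param_mem (x : X) : β.param x ∈ β.I := (β.exists_closest x).choose_spec.1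

theorem dist_param_le (x : X) {s : ℝ} (hs : s ∈ β.I) :
    dist x (β.α (β.param x)) ≤ dist x (β.α s) :=
  (β.exists_closest x).choose_spec.2 s hs

/-- Stewart's inequality along a geodesic. -/
theorem stewart (hX : IsCAT0 X) (x : X) {s t θ : ℝ} (hs : s ∈ β.I) (ht : t ∈ β.I) (hθ₀ : 0 ≤ θ)
    (hθ₁ : θ ≤ 1) :
    dist x (β.α ((1 - θ) * s + θ * t)) ^ 2 ≤
      (1 - θ) * dist x (β.α s) ^ 2 + θ * dist x (β.α t) ^ 2 - θ * (1 - θ) * (s - t) ^ 2 := by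
  have hm : (1 - θ) * s + θ * t ∈ β.I :=
    β.ordConnected.convex hs ht (by linarith) hθ₀ (by ring)
  have h := hX.stewart (a := β.α s) (b := β.α t) (m := β.α ((1 - θ) * s + θ * t)) x hθ₀ hθ₁ ?_ ?_
  · rwa [β.isGeodesic s hs t ht, sq_abs] at h
  · rw [β.isGeodesic _ hs _ hm, β.isGeodesic _ hs _ ht]
    rw [show s - ((1 - θ) * s + θ * t) = θ * (s - t) by ring, abs_mul, abs_of_nonneg hθ₀]
  · rw [β.isGeodesic _ hm _ ht, β.isGeodesic _ hs _ ht]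
    rw [show ((1 - θ) * s + θ * t) - t = (1 - θ) * (s - t) by ring, abs_mul,
      abs_of_nonneg (by linarith)]

/-- The angle at the projection of `x` is at least a right angle. -/
theorem obtuse (hX : IsCAT0 X) {x : X} {t : ℝ} (ht : t ∈ β.I)
    (hmin : ∀ s ∈ β.I, dist x (β.α t) ≤ dist x (β.α s)) {s : ℝ} (hs : s ∈ β.I) :
    dist x (β.α t) ^ 2 + (t - s) ^ 2 ≤ dist x (β.α s) ^ 2 := by
  have key : ∀ θ : ℝ, 0 < θ → θ ≤ 1 →
      dist x (β.α t) ^ 2 + (1 - θ) * (t - s) ^ 2 ≤ dist x (β.α s) ^ 2 := by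
    intro θ h0 h1
    have h := β.stewart hX x ht hs h0.le h1
    have hm : (1 - θ) * t + θ * s ∈ β.I :=
      β.ordConnected.convex ht hs (by linarith) h0.le (by ring)
    have h2 : dist x (β.α t) ^ 2 ≤ dist x (β.α ((1 - θ) * t + θ * s)) ^ 2 := by
      gcongr; exact hmin _ hm
    have h3 : 0 ≤ θ * (dist x (β.α s) ^ 2 - (1 - θ) * (t - s) ^ 2 - dist x (β.α t) ^ 2) := by
      nlinarith
    linarith [nonneg_of_mul_nonneg_right h3 h0]
  have hlim : Tendsto (fun θ : ℝ => dist x (β.α t) ^ 2 + (1 - θ) * (t - s) ^ 2) (𝓝[>] 0)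
      (𝓝 (dist x (β.α t) ^ 2 + (1 - 0) * (t - s) ^ 2)) :=
    (Continuous.tendsto (by fun_prop) 0).mono_left nhdsWithin_le_nhds
  rw [sub_zero, one_mul] at hlim
  refine le_of_tendsto hlim ?_
  filter_upwards [Ioc_mem_nhdsGT (zero_lt_one' ℝ)] with θ hθ using key θ hθ.1 hθ.2

theorem param_obtuse (hX : IsCAT0 X) (x : X) {s : ℝ} (hs : s ∈ β.I) :
    dist x (β.α (β.param x)) ^ 2 + (β.param x - s) ^ 2 ≤ dist x (β.α s) ^ 2 :=
  β.obtuse hX (β.param_mem x) (fun _ h => β.dist_param_le x h) hs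

theorem param_eq_of_closest (hX : IsCAT0 X) {x : X} {t : ℝ} (ht : t ∈ β.I)
    (hmin : ∀ s ∈ β.I, dist x (β.α t) ≤ dist x (β.α s)) : β.param x = t := by
  have h1 := β.obtuse hX ht hmin (β.param_mem x)
  have h2 := β.param_obtuse hX x ht
  nlinarith

theorem param_apply (hX : IsCAT0 X) {t : ℝ} (ht : t ∈ β.I) : β.param (β.α t) = t :=
  β.param_eq_of_closest hX ht fun s _ => by simp

theorem abs_param_sub_le (hX : IsCAT0 X) (x y : X) : |β.param x - β.param y| ≤ dist x y := by
  have h1 := β.param_obtuse hX x (β.param_mem y)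
  have h2 := β.param_obtuse hX y (β.param_mem x)
  have h3 := hX.quadrilateral x (β.α (β.param x)) (β.α (β.param y)) y
  rw [β.isGeodesic _ (β.param_mem x) _ (β.param_mem y), sq_abs, dist_comm (β.α (β.param x)) y,
    dist_comm (β.α (β.param y)) y, dist_comm y x] at h3
  refine abs_le_of_sq_le_sq ?_ dist_nonneg
  nlinarith

theorem param_continuous (hX : IsCAT0 X) : Continuous β.param := by
  refine (LipschitzWith.of_dist_le_mul (K := 1) fun x y => ?_).continuous
  rw [Real.dist_eq, NNReal.coe_one, one_mul]
  exact β.abs_param_sub_le hX x y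

theorem param_eq_of_mem_between (hX : IsCAT0 X) {x z : X}
    (hz : z ∈ between x (β.α (β.param x))) : β.param z = β.param x := by
  refine β.param_eq_of_closest hX (β.param_mem x) fun s hs => ?_
  have h1 := β.dist_param_le x hs
  have h2 := dist_triangle x z (β.α s)
  rw [mem_between] at hz
  linarith

/-- The set of points that project into a given interval is connected, because it contains the
geodesics from its points to their projections. -/
theorem isPreconnected_preimage (hX : IsCAT0 X) {S : Set ℝ} (hS : S.OrdConnected) :
    IsPreconnected (β.param ⁻¹' S) := by
  have hT : IsPreconnected (β.α '' (β.I ∩ S)) := by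
    exact (β.ordConnected.inter hS).isPreconnected.image _
      (β.continuousOn.mono Set.inter_subset_left)
  have hTs : β.α '' (β.I ∩ S) ⊆ β.param ⁻¹' S := by
    rintro _ ⟨t, ht, rfl⟩
    simpa [β.param_apply hX ht.1] using ht.2
  have hmem : ∀ x ∈ β.param ⁻¹' S, β.α (β.param x) ∈ β.α '' (β.I ∩ S) := fun x hx =>
    ⟨_, ⟨β.param_mem x, hx⟩, rfl⟩
  have hseg : ∀ x ∈ β.param ⁻¹' S, between x (β.α (β.param x)) ⊆ β.param ⁻¹' S := by
    intro x hx z hz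
    rw [Set.mem_preimage, β.param_eq_of_mem_between hX hz]; exact hx
  refine isPreconnected_of_forall_pair fun x hx y hy => ?_
  refine ⟨between x (β.α (β.param x)) ∪ β.α '' (β.I ∩ S) ∪ between y (β.α (β.param y)),
    Set.union_subset (Set.union_subset (hseg x hx) hTs) (hseg y hy),
    Or.inl (Or.inl (left_mem_between _ _)), Or.inr (left_mem_between _ _), ?_⟩
  refine IsPreconnected.union (β.α (β.param y)) (Or.inr (hmem y hy)) (right_mem_between _ _)
    (IsPreconnected.union (β.α (β.param x)) (right_mem_between _ _) (hmem x hx) ?_ hT) ?_ <;>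
  exact hX.isPreconnected_between _ _

/-- The distance to `x` increases strictly along a geodesic, away from the projection of `x`. -/
theorem dist_lt_dist (hX : IsCAT0 X) (x : X) {t θ : ℝ} (ht : t ∈ β.I) (hne : t ≠ β.param x)
    (hθ₀ : 0 ≤ θ) (hθ₁ : θ < 1) :
    dist x (β.α ((1 - θ) * β.param x + θ * t)) < dist x (β.α t) := by
  have hs := β.stewart hX x (β.param_mem x) ht hθ₀ hθ₁.le
  have ho := β.param_obtuse hX x ht
  have hpos : 0 < (β.param x - t) ^ 2 := by
    have := sub_ne_zero.2 hne.symm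
    positivity
  refine lt_of_pow_lt_pow_left₀ 2 dist_nonneg ?_
  nlinarith [mul_pos (sub_pos.2 hθ₁) hpos, mul_nonneg hθ₀ (mul_pos (sub_pos.2 hθ₁) hpos).le]

/-- The geodesic traversed backwards. -/
def reverse : Geodesic X where
  I := Neg.neg ⁻¹' β.I
  α t := β.α (-t)
  nonempty := by
    obtain ⟨t, ht⟩ := β.nonempty
    exact ⟨-t, by rwa [Set.mem_preimage, neg_neg]⟩
  ordConnected := ⟨fun a ha b hb t ht =>
    β.ordConnected.out hb ha ⟨neg_le_neg ht.2, neg_le_neg ht.1⟩⟩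
  isClosed := β.isClosed.preimage continuous_neg
  isGeodesic s hs t ht := by
    rw [β.isGeodesic _ hs _ ht, ← abs_neg]; ring_nf

theorem param_reverse (hX : IsCAT0 X) (x : X) : β.reverse.param x = -β.param x := by
  refine Geodesic.param_eq_of_closest _ hX ?_ fun s hs => ?_
  · change - -_ ∈ β.I
    rw [neg_neg]; exact β.param_mem x
  · change dist x (β.α (- -_)) ≤ dist x (β.α (-s))
    rw [neg_neg]; exact β.dist_param_le x hs

theorem exists_apply_eq {f : X → ℝ} (hf : Continuous f) {s t c : ℝ} (hs : s ∈ β.I) (ht : t ∈ β.I)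
    (hc : c ∈ Set.uIcc (f (β.α s)) (f (β.α t))) :
    ∃ r ∈ Set.uIcc s t, r ∈ β.I ∧ f (β.α r) = c := by
  have hsub := β.ordConnected.uIcc_subset hs ht
  obtain ⟨r, hr, h⟩ := intermediate_value_uIcc (f := fun u => f (β.α u))
    (hf.comp_continuousOn (β.continuousOn.mono hsub)) hc
  exact ⟨r, hr, hsub hr, h⟩

end Geodesic

/-- A geodesic from `x` to `y`. -/
theorem IsCAT0.exists_segment (hX : IsCAT0 X) (x y : X) : ∃ β : Geodesic X,
    β.I = Set.Icc 0 (dist x y) ∧ β.α 0 = x ∧ β.α (dist x y) = y := by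
  obtain ⟨γ, h0, h1, hγ⟩ := hX.exists_geodesic x y
  exact ⟨⟨Set.Icc 0 (dist x y), γ, ⟨0, le_rfl, dist_nonneg⟩, Set.ordConnected_Icc, isClosed_Icc,
    hγ⟩, rfl, h0, h1⟩

/-- If `p` lies on the geodesic from `x` to `y`, then one of `x`, `y` projects to `p` on any
geodesic that starts at `p`: the two angles at `p` add up to at least `π`. -/
theorem Geodesic.param_eq_zero_or (hX : IsCAT0 X) (β : Geodesic X) {ℓ : ℝ}
    (hI : β.I = Set.Icc 0 ℓ) (hℓ : 0 ≤ ℓ) {x y : X} (hp : β.α 0 ∈ between x y) :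
    β.param x = 0 ∨ β.param y = 0 := by
  by_contra! h
  have h0 : (0 : ℝ) ∈ β.I := by rw [hI]; exact ⟨le_rfl, hℓ⟩
  -- moving from `p` towards its projection by a common small amount shortens both distances
  have key : ∀ z, β.param z ≠ 0 → ∀ t, 0 < t → t ≤ β.param z →
      dist z (β.α t) < dist z (β.α 0) := by
    intro z hz t ht0 ht
    have hm := β.param_mem z
    have hpos : 0 < β.param z := by linarith
    have hs := β.stewart hX z h0 hm (θ := t / β.param z) (by positivity)
      ((div_le_one hpos).2 ht)
    have ho := β.param_obtuse hX z h0
    rw [mul_zero, zero_add, div_mul_cancel₀ _ hpos.ne'] at hs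
    have hθ : 0 < t / β.param z := by positivity
    have hθ1 : t / β.param z ≤ 1 := (div_le_one hpos).2 ht
    refine lt_of_pow_lt_pow_left₀ 2 dist_nonneg ?_
    rw [sub_zero] at ho
    nlinarith [mul_pos hθ (pow_pos hpos 2), mul_nonneg hθ.le (sub_nonneg.2 hθ1)]
  have hx := (hI ▸ β.param_mem x : β.param x ∈ Set.Icc 0 ℓ)
  have hy := (hI ▸ β.param_mem y : β.param y ∈ Set.Icc 0 ℓ)
  have hx0 := lt_of_le_of_ne hx.1 h.1.symm
  have hy0 := lt_of_le_of_ne hy.1 h.2.symm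
  have k1 := key x h.1 _ (lt_min hx0 hy0) (min_le_left _ _)
  have k2 := key y h.2 _ (lt_min hx0 hy0) (min_le_right _ _)
  have := dist_triangle x (β.α (min (β.param x) (β.param y))) y
  rw [mem_between] at hp
  rw [dist_comm y, dist_comm y] at k2
  linarith

/-! ### Curtains as slabs of a coordinate function -/

namespace Curtain

variable (h : Curtain X)

/-- The geodesic to which the curtain is dual. -/
def toGeodesic : Geodesic X where
  I := h.I
  α := h.α
  nonempty := ⟨h.r, interior_subset (h.pole_subset ⟨by linarith, by linarith⟩)⟩
  ordConnected := h.ordConnected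
  isClosed := h.isClosed
  isGeodesic := h.isGeodesic

/-- The signed position of `x` with respect to the curtain: the parameter of the projection of `x`
to the dual geodesic, measured from the centre of the pole. The curtain and its half spaces are
the preimages of `[-1/2, 1/2]`, `(-∞, -1/2)` and `(1/2, ∞)`. -/
noncomputable def coord (x : X) : ℝ := h.toGeodesic.param x - h.r

theorem mem_projPreimage (hX : IsCAT0 X) {S : Set ℝ} {x : X} :
    x ∈ h.projPreimage S ↔ h.toGeodesic.param x ∈ S := by
  constructor
  · rintro ⟨t, ⟨ht, htS⟩, -, hmin⟩
    have : h.toGeodesic.param x = t :=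
      h.toGeodesic.param_eq_of_closest hX ht fun s hs => hmin _ ⟨s, hs, rfl⟩
    rwa [this]
  · intro hx
    refine ⟨_, ⟨h.toGeodesic.param_mem x, hx⟩, ⟨_, h.toGeodesic.param_mem x, rfl⟩, ?_⟩
    rintro _ ⟨s, hs, rfl⟩
    exact h.toGeodesic.dist_param_le x hs

theorem mem_carrier (hX : IsCAT0 X) {x : X} :
    x ∈ h.carrier ↔ -(1 / 2) ≤ h.coord x ∧ h.coord x ≤ 1 / 2 := by
  rw [carrier, mem_projPreimage h hX, Set.mem_Icc, coord]
  constructor <;> rintro ⟨h1, h2⟩ <;> constructor <;> linarith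

theorem mem_minus (hX : IsCAT0 X) {x : X} : x ∈ h.minus ↔ h.coord x < -(1 / 2) := by
  rw [minus, mem_projPreimage h hX, Set.mem_Iio, coord]
  constructor <;> intro <;> linarith

theorem mem_plus (hX : IsCAT0 X) {x : X} : x ∈ h.plus ↔ 1 / 2 < h.coord x := by
  rw [plus, mem_projPreimage h hX, Set.mem_Ioi, coord]
  constructor <;> intro <;> linarith

theorem abs_coord_sub_le (hX : IsCAT0 X) (x y : X) : |h.coord x - h.coord y| ≤ dist x y := by
  simpa [coord] using h.toGeodesic.abs_param_sub_le hX x y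

theorem coord_continuous (hX : IsCAT0 X) : Continuous h.coord :=
  (h.toGeodesic.param_continuous hX).sub continuous_const

theorem isPreconnected_coord_preimage (hX : IsCAT0 X) {S : Set ℝ} (hS : S.OrdConnected) :
    IsPreconnected (h.coord ⁻¹' S) := by
  have hS' : ((fun t => t - h.r) ⁻¹' S).OrdConnected :=
    hS.preimage_mono fun a b hab => sub_le_sub_right hab _
  exact h.toGeodesic.isPreconnected_preimage hX hS'

theorem carrier_eq (hX : IsCAT0 X) : h.carrier = h.coord ⁻¹' Set.Icc (-(1 / 2)) (1 / 2) := by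
  ext x; exact h.mem_carrier hX

theorem isPreconnected_carrier (hX : IsCAT0 X) : IsPreconnected h.carrier := by
  rw [h.carrier_eq hX]; exact h.isPreconnected_coord_preimage hX Set.ordConnected_Icc

theorem exists_coord_eq_zero (hX : IsCAT0 X) : ∃ x, h.coord x = 0 := by
  have hr : h.r ∈ h.toGeodesic.I :=
    interior_subset (h.pole_subset ⟨by linarith, by linarith⟩)
  exact ⟨h.α h.r, by rw [coord, sub_eq_zero]; exact h.toGeodesic.param_apply hX hr⟩

/-- The curtain with the direction of its dual geodesic reversed. -/
def flip : Curtain X where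
  I := h.toGeodesic.reverse.I
  α := h.toGeodesic.reverse.α
  r := -h.r
  ordConnected := h.toGeodesic.reverse.ordConnected
  isClosed := h.toGeodesic.reverse.isClosed
  isGeodesic := h.toGeodesic.reverse.isGeodesic
  pole_subset := by
    intro t ht
    have : -t ∈ interior h.I := h.pole_subset ⟨by linarith [ht.2], by linarith [ht.1]⟩
    exact preimage_interior_subset_interior_preimage continuous_neg this

theorem coord_flip (hX : IsCAT0 X) (x : X) : h.flip.coord x = -h.coord x := by
  rw [coord, coord, show h.flip.toGeodesic.param x = _ from h.toGeodesic.param_reverse hX x,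
    show h.flip.r = -h.r from rfl]
  ring

/-- The image of a curtain under an isometry. -/
def map (g : X ≃ᵢ X) : Curtain X where
  I := h.I
  α t := g (h.α t)
  r := h.r
  ordConnected := h.ordConnected
  isClosed := h.isClosed
  isGeodesic s hs t ht := by rw [g.dist_eq, h.isGeodesic s hs t ht]
  pole_subset := h.pole_subset

theorem coord_map (hX : IsCAT0 X) (g : X ≃ᵢ X) (x : X) :
    (h.map g).coord x = h.coord (g.symm x) := by
  have : (h.map g).toGeodesic.param x = h.toGeodesic.param (g.symm x) := by
    refine Geodesic.param_eq_of_closest _ hX (h.toGeodesic.param_mem _) fun s hs => ?_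
    change dist x (g (h.α _)) ≤ dist x (g (h.α s))
    rw [← g.symm.dist_eq, ← g.symm.dist_eq x, g.symm_apply_apply, g.symm_apply_apply]
    exact h.toGeodesic.dist_param_le _ hs
  rw [coord, coord, this]; rfl

/-- `h` precedes `k`: the curtain `h` and its half space `h⁻` lie in `k⁻`. -/
def Prec (h k : Curtain X) : Prop := ∀ z, h.coord z ≤ 1 / 2 → k.coord z < -(1 / 2)

variable {h}
variable {k l : Curtain X}

theorem Prec.trans (h₁ : Prec h k) (h₂ : Prec k l) : Prec h l := fun z hz =>
  h₂ z (by linarith [h₁ z hz])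

theorem Prec.coord_gt (H : Prec h k) {z : X} (hz : -(1 / 2) ≤ k.coord z) :
    1 / 2 < h.coord z := by
  by_contra! h'
  linarith [H z h']

theorem Prec.disjoint (hX : IsCAT0 X) (H : Prec h k) : Disjoint h.carrier k.carrier := by
  rw [Set.disjoint_left]
  intro z hz hz'
  rw [mem_carrier _ hX] at hz hz'
  linarith [H z hz.2]

theorem Prec.flip (hX : IsCAT0 X) (H : Prec h k) : Prec k.flip h.flip := by
  intro z hz
  rw [coord_flip _ hX] at hz ⊢
  linarith [H.coord_gt (z := z) (by linarith)]

theorem Prec.map (hX : IsCAT0 X) (H : Prec h k) (g : X ≃ᵢ X) : Prec (h.map g) (k.map g) := by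
  intro z hz
  rw [coord_map _ hX] at hz ⊢
  exact H _ hz

theorem carrier_flip (hX : IsCAT0 X) : h.flip.carrier = h.carrier := by
  ext z
  rw [mem_carrier _ hX, mem_carrier _ hX, coord_flip _ hX]
  constructor <;> rintro ⟨h1, h2⟩ <;> constructor <;> linarith

theorem minus_flip (hX : IsCAT0 X) : h.flip.minus = h.plus := by
  ext z
  rw [mem_minus _ hX, mem_plus _ hX, coord_flip _ hX]
  constructor <;> intro <;> linarith

theorem plus_flip (hX : IsCAT0 X) : h.flip.plus = h.minus := by
  ext z
  rw [mem_minus _ hX, mem_plus _ hX, coord_flip _ hX]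
  constructor <;> intro <;> linarith

/-- Of two disjoint curtains, one lies in a half space of the other, because it is connected. -/
theorem subset_plus_or_minus (hX : IsCAT0 X) (hd : Disjoint h.carrier k.carrier) :
    k.carrier ⊆ h.plus ∨ k.carrier ⊆ h.minus := by
  by_contra! H
  obtain ⟨⟨a, ha, ha'⟩, ⟨b, hb, hb'⟩⟩ := And.imp Set.not_subset.1 Set.not_subset.1 H
  rw [mem_plus _ hX] at ha'
  rw [mem_minus _ hX] at hb'
  have hna := Set.disjoint_right.1 hd ha
  have hnb := Set.disjoint_right.1 hd hb
  rw [mem_carrier _ hX] at hna hnb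
  have ha2 : h.coord a < -(1 / 2) := by
    by_contra! h2; exact hna ⟨h2, by linarith⟩
  have hb2 : 1 / 2 < h.coord b := by
    by_contra! h2; exact hnb ⟨by linarith, h2⟩
  obtain ⟨z, hz, hz0⟩ := (k.isPreconnected_carrier hX).intermediate_value ha hb
    (h.coord_continuous hX).continuousOn ⟨(by linarith : h.coord a ≤ 0), by linarith⟩
  exact Set.disjoint_right.1 hd hz ((h.mem_carrier hX).2 ⟨by linarith, by linarith⟩)

theorem prec_of_subset (hX : IsCAT0 X) (hk : k.carrier ⊆ h.plus) (hh : h.carrier ⊆ k.minus) :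
    Prec h k := by
  intro z hz
  by_contra! hz'
  obtain ⟨p, hp⟩ := h.exists_coord_eq_zero hX
  have hpm := (k.mem_minus hX).1 (hh ((h.mem_carrier hX (x := p)).2 ⟨by linarith, by linarith⟩))
  obtain ⟨w, hw, hw0⟩ := (h.isPreconnected_coord_preimage hX
    (S := Set.Iic (1 / 2)) Set.ordConnected_Iic).intermediate_value
    (show h.coord p ≤ 1 / 2 by linarith) hz (k.coord_continuous hX).continuousOn ⟨hpm.le, hz'⟩
  have := (h.mem_plus hX).1 (hk ((k.mem_carrier hX).2 ⟨hw0.ge, by linarith⟩))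
  have hw' : h.coord w ≤ 1 / 2 := hw
  linarith

theorem Prec.carrier_subset_minus (hX : IsCAT0 X) (H : Prec h k) : h.carrier ⊆ k.minus :=
  fun _ hz => (k.mem_minus hX).2 (H _ ((h.mem_carrier hX).1 hz).2)

theorem Prec.carrier_subset_plus (hX : IsCAT0 X) (H : Prec h k) : k.carrier ⊆ h.plus :=
  fun _ hz => (h.mem_plus hX).2 (H.coord_gt ((k.mem_carrier hX).1 hz).1)

instance : IsTrans (Curtain X) Prec := ⟨fun _ _ _ => Prec.trans⟩

end Curtain

open Curtain

/-! ### Chains -/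

/-- A family of curtains is ordered if each of its members precedes all later ones. -/
def IsOrdered {n : ℕ} (c : Fin n → Curtain X) : Prop := ∀ i j, i < j → Prec (c i) (c j)

theorem IsOrdered.isChain (hX : IsCAT0 X) {n : ℕ} {c : Fin n → Curtain X} (hc : IsOrdered c) :
    IsChain c := by
  refine ⟨fun i j hij => (hc i j (Fin.lt_def.2 (by omega))).disjoint hX,
    fun i j k hij hjk => Or.inl ⟨?_, ?_⟩⟩
  · exact (hc i j (Fin.lt_def.2 (by omega))).carrier_subset_minus hX
  · exact (hc j k (Fin.lt_def.2 (by omega))).carrier_subset_plus hX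

theorem IsOrdered.comp {m n : ℕ} {c : Fin n → Curtain X} (hc : IsOrdered c) {f : Fin m → Fin n}
    (hf : StrictMono f) : IsOrdered (c ∘ f) := fun _ _ hij => hc _ _ (hf hij)

/-- The dual geodesics of the members of a chain can be directed consistently. -/
theorem IsChain.exists_ordered (hX : IsCAT0 X) {n : ℕ} {c : Fin n → Curtain X} (hc : IsChain c) :
    ∃ c' : Fin n → Curtain X, IsOrdered c' ∧ ∀ i, c' i = c i ∨ c' i = (c i).flip := by
  have key : ∀ i : Fin n, ∃ h : Curtain X, (h = c i ∨ h = (c i).flip) ∧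
      (∀ j : Fin n, (i : ℕ) + 1 = j → (c j).carrier ⊆ h.plus) ∧
      (∀ j : Fin n, (j : ℕ) + 1 = i → (c j).carrier ⊆ h.minus) := by
    intro i
    by_cases hp : ∃ j : Fin n, (i : ℕ) + 1 = j
    · obtain ⟨j, hj⟩ := hp
      have hju : ∀ j' : Fin n, (i : ℕ) + 1 = j' → j' = j := fun j' h => Fin.ext (by omega)
      by_cases hm : ∃ k : Fin n, (k : ℕ) + 1 = i
      · obtain ⟨k, hk⟩ := hm
        have hku : ∀ k' : Fin n, (k' : ℕ) + 1 = i → k' = k := fun j' h => Fin.ext (by omega)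
        rcases hc.2 k i j hk hj with H | H
        · exact ⟨_, Or.inl rfl, fun j' h => hju j' h ▸ H.2, fun k' h => hku k' h ▸ H.1⟩
        · refine ⟨_, Or.inr rfl, fun j' h => ?_, fun k' h => ?_⟩
          · rw [plus_flip hX, hju j' h]; exact H.2
          · rw [minus_flip hX, hku k' h]; exact H.1
      · rcases subset_plus_or_minus hX (hc.1 i j hj) with H | H
        · exact ⟨_, Or.inl rfl, fun j' h => hju j' h ▸ H, fun k' h => absurd ⟨k', h⟩ hm⟩
        · refine ⟨_, Or.inr rfl, fun j' h => ?_, fun k' h => absurd ⟨k', h⟩ hm⟩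
          rw [plus_flip hX, hju j' h]; exact H
    · by_cases hm : ∃ k : Fin n, (k : ℕ) + 1 = i
      · obtain ⟨k, hk⟩ := hm
        have hku : ∀ k' : Fin n, (k' : ℕ) + 1 = i → k' = k := fun j' h => Fin.ext (by omega)
        rcases subset_plus_or_minus hX (hc.1 k i hk).symm with H | H
        · refine ⟨_, Or.inr rfl, fun j' h => absurd ⟨j', h⟩ hp, fun k' h => ?_⟩
          rw [minus_flip hX, hku k' h]; exact H
        · exact ⟨_, Or.inl rfl, fun j' h => absurd ⟨j', h⟩ hp, fun k' h => hku k' h ▸ H⟩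
      · exact ⟨_, Or.inl rfl, fun j' h => absurd ⟨j', h⟩ hp, fun k' h => absurd ⟨k', h⟩ hm⟩
  choose c' hc' hplus hminus using key
  refine ⟨c', ?_, hc'⟩
  have hcar : ∀ i, (c' i).carrier = (c i).carrier := by
    intro i
    rcases hc' i with h | h <;> rw [h]
    exact carrier_flip hX
  have hstep : ∀ i j : Fin n, (i : ℕ) + 1 = j → Prec (c' i) (c' j) := by
    intro i j hij
    refine prec_of_subset hX ?_ ?_
    · rw [hcar]; exact hplus i j hij
    · rw [hcar]; exact hminus j i hij
  cases n with
  | zero => exact fun i => i.elim0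
  | succ n =>
    have := (Fin.liftFun_iff_succ (Prec (X := X)) (f := c')).2 fun i => hstep _ _ (by simp)
    exact fun i j hij => this hij

/-- The number of curtains in an ordered family that separates `x` from `y` is at most the
distance from `x` to `y`, because the half spaces of a curtain are at distance `1`. -/
theorem IsOrdered.card_le_dist (hX : IsCAT0 X) {n : ℕ} {c : Fin n → Curtain X}
    (hc : IsOrdered c) {x y : X} (hx : ∀ i, (c i).coord x ≤ -(1 / 2))
    (hy : ∀ i, 1 / 2 ≤ (c i).coord y) : (n : ℝ) ≤ dist x y := by
  induction n generalizing y with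
  | zero => simp
  | succ n ih =>
    obtain ⟨w, hw, hw0⟩ := hX.exists_mem_between ((c (Fin.last n)).coord_continuous hX)
      (hx (Fin.last n)) (y := y) (by linarith [hy (Fin.last n)])
    have h1 := ih (c := c ∘ Fin.castSucc) (hc.comp Fin.strictMono_castSucc) (y := w)
      (fun i => hx _) fun i =>
        ((hc (Fin.castSucc i) _ (Fin.castSucc_lt_last i)).coord_gt hw0.ge).le
    have h2 := (c (Fin.last n)).abs_coord_sub_le hX w y
    have h3 := neg_abs_le ((c (Fin.last n)).coord w - (c (Fin.last n)).coord y)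
    have h4 := hy (Fin.last n)
    rw [mem_between] at hw
    push_cast
    linarith

theorem LSeparated.congr {L : ℕ} {h k h' k' : Curtain X} (H : LSeparated L h k)
    (hh : h'.carrier = h.carrier) (hk : k'.carrier = k.carrier) : LSeparated L h' k' := by
  unfold LSeparated; rw [hh, hk]; exact H

theorem LSeparated.symm {L : ℕ} {h k : Curtain X} (H : LSeparated L h k) : LSeparated L k h :=
  ⟨H.1.symm, fun n c hc hm => H.2 n c hc fun i => (hm i).symm⟩

theorem carrier_map (hX : IsCAT0 X) (h : Curtain X) (g : X ≃ᵢ X) {x : X} :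
    g x ∈ (h.map g).carrier ↔ x ∈ h.carrier := by
  rw [Curtain.mem_carrier _ hX, Curtain.mem_carrier _ hX, coord_map _ hX, g.symm_apply_apply]

theorem carrier_map_symm (hX : IsCAT0 X) (h : Curtain X) (g : X ≃ᵢ X) {x : X} :
    g.symm x ∈ (h.map g.symm).carrier ↔ x ∈ h.carrier := carrier_map hX h g.symm

theorem IsChain.map (hX : IsCAT0 X) {n : ℕ} {c : Fin n → Curtain X} (hc : IsChain c)
    (g : X ≃ᵢ X) : IsChain fun i => (c i).map g := by
  obtain ⟨c', ho, hc'⟩ := hc.exists_ordered hX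
  have hpm : ∀ (h : Curtain X) x, (x ∈ (h.map g).minus ↔ g.symm x ∈ h.minus) ∧
      (x ∈ (h.map g).plus ↔ g.symm x ∈ h.plus) ∧
      (x ∈ (h.map g).carrier ↔ g.symm x ∈ h.carrier) := by
    intro h x
    simp only [Curtain.mem_minus _ hX, Curtain.mem_plus _ hX, Curtain.mem_carrier _ hX,
      coord_map _ hX, and_self]
  refine ⟨fun i j hij => ?_, fun i j k hij hjk => ?_⟩
  · rw [Set.disjoint_left]
    intro z hz hz'
    exact Set.disjoint_left.1 (hc.1 i j hij) ((hpm _ _).2.2.1 hz) ((hpm _ _).2.2.1 hz')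
  · refine (hc.2 i j k hij hjk).imp (fun H => ⟨fun z hz => ?_, fun z hz => ?_⟩)
      (fun H => ⟨fun z hz => ?_, fun z hz => ?_⟩)
    · exact (hpm _ _).1.2 (H.1 ((hpm _ _).2.2.1 hz))
    · exact (hpm _ _).2.1.2 (H.2 ((hpm _ _).2.2.1 hz))
    · exact (hpm _ _).2.1.2 (H.1 ((hpm _ _).2.2.1 hz))
    · exact (hpm _ _).1.2 (H.2 ((hpm _ _).2.2.1 hz))

theorem LSeparated.map (hX : IsCAT0 X) {L : ℕ} {h k : Curtain X} (H : LSeparated L h k)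
    (g : X ≃ᵢ X) : LSeparated L (h.map g) (k.map g) := by
  have back : ∀ (l : Curtain X) x, x ∈ (l.map g).carrier → g.symm x ∈ l.carrier := by
    intro l x hx
    rw [← carrier_map hX l g, g.apply_symm_apply]; exact hx
  refine ⟨?_, fun n c hc hm => H.2 n _ (hc.map hX g.symm) fun i => ⟨?_, ?_⟩⟩
  · rw [Set.disjoint_left]
    exact fun z hz hz' => Set.disjoint_left.1 H.1 (back _ _ hz) (back _ _ hz')
  · obtain ⟨x, hx, hx'⟩ := (hm i).1
    exact ⟨g.symm x, (carrier_map_symm hX _ g).2 hx, back _ _ hx'⟩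
  · obtain ⟨x, hx, hx'⟩ := (hm i).2
    exact ⟨g.symm x, (carrier_map_symm hX _ g).2 hx, back _ _ hx'⟩

/-- A consistently directed `L`-chain from `x` to `y`. -/
structure IsLChainFromTo (L : ℕ) {n : ℕ} (c : Fin n → Curtain X) (x y : X) : Prop where
  ordered : IsOrdered c
  separated : ∀ i j, i ≠ j → LSeparated L (c i) (c j)
  left : ∀ i, (c i).coord x < -(1 / 2)
  right : ∀ i, 1 / 2 < (c i).coord y

namespace IsLChainFromTo

variable {L n : ℕ} {c : Fin n → Curtain X} {x y : X}

theorem card_le_dist (hX : IsCAT0 X) (hc : IsLChainFromTo L c x y) : (n : ℝ) ≤ dist x y :=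
  hc.ordered.card_le_dist hX (fun i => (hc.left i).le) fun i => (hc.right i).le

theorem isLChain (hX : IsCAT0 X) (hc : IsLChainFromTo L c x y) : IsLChain L c :=
  ⟨hc.ordered.isChain hX, hc.separated⟩

theorem separates (hX : IsCAT0 X) (hc : IsLChainFromTo L c x y) (i : Fin n) :
    (c i).Separates {x} {y} := by
  refine Or.inl ⟨?_, ?_⟩ <;> rw [Set.singleton_subset_iff]
  · exact (mem_minus _ hX).2 (hc.left i)
  · exact (mem_plus _ hX).2 (hc.right i)

theorem reverse (hX : IsCAT0 X) (hc : IsLChainFromTo L c x y) :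
    IsLChainFromTo L (fun i => (c i.rev).flip) y x where
  ordered i j hij := (hc.ordered _ _ (Fin.rev_lt_rev.2 hij)).flip hX
  separated _ _ hij := (hc.separated _ _ (Fin.rev_injective.ne hij)).congr (carrier_flip hX)
    (carrier_flip hX)
  left i := by rw [coord_flip _ hX]; linarith [hc.right i.rev]
  right i := by rw [coord_flip _ hX]; linarith [hc.left i.rev]

theorem map (hX : IsCAT0 X) (hc : IsLChainFromTo L c x y) (g : X ≃ᵢ X) :
    IsLChainFromTo L (fun i => (c i).map g) (g x) (g y) where
  ordered i j hij := (hc.ordered _ _ hij).map hX g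
  separated _ _ hij := (hc.separated _ _ hij).map hX g
  left i := by rw [coord_map _ hX, g.symm_apply_apply]; exact hc.left i
  right i := by rw [coord_map _ hX, g.symm_apply_apply]; exact hc.right i

end IsLChainFromTo

theorem IsLChain.exists_fromTo (hX : IsCAT0 X) {L n : ℕ} {c : Fin n → Curtain X} {x y : X}
    (hc : IsLChain L c) (hs : ∀ i, (c i).Separates {x} {y}) :
    ∃ c' : Fin n → Curtain X, IsLChainFromTo L c' x y := by
  obtain ⟨c', ho, hc'⟩ := hc.1.exists_ordered hX
  have hcar : ∀ i, (c' i).carrier = (c i).carrier := by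
    intro i
    rcases hc' i with h | h <;> rw [h]
    exact carrier_flip hX
  have hsep : ∀ i j, i ≠ j → LSeparated L (c' i) (c' j) := fun i j hij =>
    (hc.2 i j hij).congr (hcar i) (hcar j)
  have hs' : ∀ i, ((c' i).coord x < -(1 / 2) ∧ 1 / 2 < (c' i).coord y) ∨
      (1 / 2 < (c' i).coord x ∧ (c' i).coord y < -(1 / 2)) := by
    intro i
    have h := hs i
    unfold Curtain.Separates at h
    simp only [Set.singleton_subset_iff, mem_minus _ hX, mem_plus _ hX] at h
    rcases hc' i with e | e <;> rw [e]
    · exact h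
    · rw [coord_flip _ hX, coord_flip _ hX]
      rcases h with ⟨h1, h2⟩ | ⟨h1, h2⟩
      · right; constructor <;> linarith
      · left; constructor <;> linarith
  -- an ordered family cannot separate `x` from `y` in both directions
  by_cases H : ∃ i, 1 / 2 < (c' i).coord x
  · obtain ⟨i, hi⟩ := H
    have hall : ∀ j, 1 / 2 < (c' j).coord x ∧ (c' j).coord y < -(1 / 2) := by
      intro j
      rcases hs' j with h | h
      · exfalso
        rcases hs' i with h' | h'
        · linarith [h'.1]
        · rcases lt_trichotomy i j with hij | rfl | hij
          · linarith [ho i j hij y (by linarith [h'.2]), h.2]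
          · linarith [h.1]
          · linarith [ho j i hij x (by linarith [h.1])]
      · exact h
    exact ⟨_, IsLChainFromTo.reverse hX (x := y) (y := x)
      ⟨ho, hsep, fun j => (hall j).2, fun j => (hall j).1⟩⟩
  · push Not at H
    have hall : ∀ j, (c' j).coord x < -(1 / 2) ∧ 1 / 2 < (c' j).coord y := fun j =>
      (hs' j).resolve_right fun h => by linarith [h.1, H j]
    exact ⟨c', ho, hsep, fun j => (hall j).1, fun j => (hall j).2⟩

/-! ### The metrics of the spaces `X_L` and of the curtain model -/

open Classical in
theorem distL_eq (hX : IsCAT0 X) (L : ℕ) (x y : X) : distL L x y = if x = y then 0 else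
    1 + ((sSup {n : ℕ | ∃ c : Fin n → Curtain X, IsLChainFromTo L c x y} : ℕ) : ℝ) := by
  have : {n : ℕ | ∃ c : Fin n → Curtain X, IsLChain L c ∧ ∀ i, (c i).Separates {x} {y}} =
      {n : ℕ | ∃ c : Fin n → Curtain X, IsLChainFromTo L c x y} := by
    ext n
    constructor
    · rintro ⟨c, hc, hs⟩
      exact hc.exists_fromTo hX hs
    · rintro ⟨c, hc⟩
      exact ⟨c, hc.isLChain hX, hc.separates hX⟩
  rw [distL, this]

theorem bddAbove_chainLengths (hX : IsCAT0 X) (L : ℕ) (x y : X) :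
    BddAbove {n : ℕ | ∃ c : Fin n → Curtain X, IsLChainFromTo L c x y} := by
  refine ⟨⌊dist x y⌋₊, ?_⟩
  rintro n ⟨c, hc⟩
  exact Nat.le_floor (hc.card_le_dist hX)

theorem distL_self (L : ℕ) (x : X) : distL L x x = 0 := by simp [distL]

theorem distL_nonneg (L : ℕ) (x y : X) : 0 ≤ distL L x y := by
  unfold distL; split_ifs <;> positivity

theorem exists_chain_distL (hX : IsCAT0 X) (L : ℕ) {x y : X} (hxy : x ≠ y) :
    ∃ (n : ℕ) (c : Fin n → Curtain X), IsLChainFromTo L c x y ∧ distL L x y = 1 + n := by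
  have := Nat.sSup_mem (s := {n : ℕ | ∃ c : Fin n → Curtain X, IsLChainFromTo L c x y})
    ⟨0, fun i => i.elim0, fun i => i.elim0, fun i => i.elim0, fun i => i.elim0, fun i => i.elim0⟩
    (bddAbove_chainLengths hX L x y)
  obtain ⟨c, hc⟩ := this
  exact ⟨_, c, hc, by rw [distL_eq hX, if_neg hxy]⟩

theorem IsLChainFromTo.add_one_le_distL (hX : IsCAT0 X) {L n : ℕ} {c : Fin n → Curtain X} {x y : X}
    (hxy : x ≠ y) (hc : IsLChainFromTo L c x y) : (1 : ℝ) + n ≤ distL L x y := by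
  rw [distL_eq hX, if_neg hxy]
  gcongr
  exact le_csSup (bddAbove_chainLengths hX L x y) ⟨c, hc⟩

theorem distL_le (hX : IsCAT0 X) (L : ℕ) (x y : X) : distL L x y ≤ 1 + dist x y := by
  rcases eq_or_ne x y with rfl | hxy
  · simp [distL_self]
  · obtain ⟨n, c, hc, h⟩ := exists_chain_distL hX L hxy
    rw [h]
    linarith [hc.card_le_dist hX]

theorem distL_comm_le (hX : IsCAT0 X) (L : ℕ) (x y : X) : distL L x y ≤ distL L y x := by
  rcases eq_or_ne x y with rfl | hxy
  · rfl
  · obtain ⟨n, c, hc, h⟩ := exists_chain_distL hX L hxy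
    rw [h]
    exact (hc.reverse hX).add_one_le_distL hX hxy.symm

theorem distL_map_le (hX : IsCAT0 X) (L : ℕ) (g : X ≃ᵢ X) (x y : X) :
    distL L x y ≤ distL L (g x) (g y) := by
  rcases eq_or_ne x y with rfl | hxy
  · simp [distL_self]
  · obtain ⟨n, c, hc, h⟩ := exists_chain_distL hX L hxy
    rw [h]
    exact (hc.map hX g).add_one_le_distL hX (g.injective.ne hxy)

theorem IsLChainFromTo.restrict {L n : ℕ} {c : Fin n → Curtain X} {x y x' y' : X}
    (hc : IsLChainFromTo L c x y) (S : Finset (Fin n)) (hl : ∀ i ∈ S, (c i).coord x' < -(1 / 2))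
    (hr : ∀ i ∈ S, 1 / 2 < (c i).coord y') :
    IsLChainFromTo L (c ∘ S.orderEmbOfFin rfl) x' y' where
  ordered := hc.ordered.comp (S.orderEmbOfFin rfl).strictMono
  separated _ _ hij := hc.separated _ _ ((S.orderEmbOfFin rfl).injective.ne hij)
  left i := hl _ (S.orderEmbOfFin_mem rfl i)
  right i := hr _ (S.orderEmbOfFin_mem rfl i)

theorem distL_triangle (hX : IsCAT0 X) (L : ℕ) (x y z : X) :
    distL L x z ≤ distL L x y + distL L y z := by
  rcases eq_or_ne x y with rfl | hxy
  · simp [distL_self]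
  rcases eq_or_ne y z with rfl | hyz
  · simp [distL_self]
  rcases eq_or_ne x z with rfl | hxz
  · rw [distL_self]; exact add_nonneg (distL_nonneg _ _ _) (distL_nonneg _ _ _)
  obtain ⟨n, c, hc, h⟩ := exists_chain_distL hX L hxz
  rw [h]
  -- at most one of the curtains contains `y`; the others separate `y` from `x` or from `z`
  set S : Finset (Fin n) := {i | 1 / 2 < (c i).coord y}
  set T : Finset (Fin n) := {i | (c i).coord y < -(1 / 2)}
  have h1 := (hc.restrict S (fun i _ => hc.left i)
    (fun i hi => (Finset.mem_filter.1 hi).2)).add_one_le_distL hX hxy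
  have h2 := (hc.restrict T (fun i hi => (Finset.mem_filter.1 hi).2)
    (fun i _ => hc.right i)).add_one_le_distL hX hyz
  have h3 : ((S ∪ T)ᶜ).card ≤ 1 := by
    rw [Finset.card_le_one]
    have key : ∀ i ∈ (S ∪ T)ᶜ, -(1 / 2) ≤ (c i).coord y ∧ (c i).coord y ≤ 1 / 2 := by
      intro i hi
      simp only [Finset.compl_union, Finset.mem_inter, Finset.mem_compl, S, T, Finset.mem_filter,
        Finset.mem_univ, true_and, not_lt] at hi
      exact ⟨hi.2, hi.1⟩
    intro i hi j hj
    rcases lt_trichotomy i j with hij | hij | hij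
    · linarith [hc.ordered i j hij y (key i hi).2, (key j hj).1]
    · exact hij
    · linarith [hc.ordered j i hij y (key j hj).2, (key i hi).1]
  have h4 : n ≤ S.card + T.card + 1 := by
    have := Finset.card_add_card_compl (S ∪ T)
    rw [Fintype.card_fin] at this
    have := Finset.card_union_le S T
    omega
  have h5 : (n : ℝ) ≤ S.card + T.card + 1 := by exact_mod_cast h4
  linarith

/-- A pseudometric on `X`, as a function of two points, that is invariant under the isometries of
`X`. -/
structure IsInvariantDist (d : X → X → ℝ) : Prop where
  self : ∀ x, d x x = 0
  nonneg : ∀ x y, 0 ≤ d x y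
  comm : ∀ x y, d x y = d y x
  triangle : ∀ x y z, d x z ≤ d x y + d y z
  map : ∀ (g : X ≃ᵢ X) x y, d (g x) (g y) = d x y

theorem isInvariantDist_dist : IsInvariantDist (dist : X → X → ℝ) :=
  ⟨dist_self, fun _ _ => dist_nonneg, dist_comm, dist_triangle, fun g => g.dist_eq⟩

theorem isInvariantDist_distL (hX : IsCAT0 X) (L : ℕ) :
    IsInvariantDist (distL L : X → X → ℝ) where
  self := distL_self L
  nonneg := distL_nonneg L
  comm x y := le_antisymm (distL_comm_le hX L x y) (distL_comm_le hX L y x)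
  triangle := distL_triangle hX L
  map g x y := by
    refine le_antisymm ?_ (distL_map_le hX L g x y)
    simpa using distL_map_le hX L g.symm (g x) (g y)

theorem summable_distD (hX : IsCAT0 X) {w : ℕ+ → ℝ} (hw : IsCurtainWeight w) (x y : X) :
    Summable fun L : ℕ+ => w L * distL (L : ℕ) x y := by
  refine Summable.of_nonneg_of_le
    (fun L => mul_nonneg (hw.mem_Ioo L).1.le (distL_nonneg _ _ _)) (fun L => ?_)
    (hw.hasSum_one.summable.mul_right (1 + dist x y))
  exact mul_le_mul_of_nonneg_left (distL_le hX _ _ _) (hw.mem_Ioo L).1.le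

theorem isInvariantDist_distD (hX : IsCAT0 X) {w : ℕ+ → ℝ} (hw : IsCurtainWeight w) :
    IsInvariantDist (distD w : X → X → ℝ) where
  self x := by simp [distD, distL_self]
  nonneg x y := tsum_nonneg fun L => mul_nonneg (hw.mem_Ioo L).1.le (distL_nonneg _ _ _)
  comm x y := by simp_rw [distD, (isInvariantDist_distL hX _).comm x y]
  triangle x y z := by
    unfold distD
    rw [← (summable_distD hX hw x y).tsum_add (summable_distD hX hw y z)]
    refine (summable_distD hX hw x z).tsum_le_tsum (fun L => ?_)
      ((summable_distD hX hw x y).add (summable_distD hX hw y z))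
    rw [← mul_add]
    exact mul_le_mul_of_nonneg_left (distL_triangle hX _ _ _ _) (hw.mem_Ioo L).1.le
  map g x y := by simp_rw [distD, (isInvariantDist_distL hX _).map g x y]

theorem mul_distL_le_distD (hX : IsCAT0 X) {w : ℕ+ → ℝ} (hw : IsCurtainWeight w) (L : ℕ+)
    (x y : X) : w L * distL (L : ℕ) x y ≤ distD w x y :=
  (summable_distD hX hw x y).le_tsum L fun M _ =>
    mul_nonneg (hw.mem_Ioo M).1.le (distL_nonneg _ _ _)

/-! ### Translation lengths -/

namespace IsInvariantDist

variable {d : X → X → ℝ}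

theorem dist_orbit_le (hd : IsInvariantDist d) (h : X ≃ᵢ X) (x y : X) :
    d y (h y) ≤ d x (h x) + 2 * d x y := by
  have h1 := hd.triangle y x (h y)
  have h2 := hd.triangle x (h x) (h y)
  rw [hd.map] at h2
  rw [hd.comm y x] at h1
  linarith

theorem exists_isTranslationLength (hd : IsInvariantDist d) (g : X ≃ᵢ X) :
    ∃ t, IsTranslationLength d g t := by
  rcases isEmpty_or_nonempty X with hE | ⟨⟨x₀⟩⟩
  · exact ⟨0, fun x => hE.elim x⟩
  have hsub : Subadditive fun n : ℕ => d x₀ ((g ^ n) x₀) := by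
    intro m n
    have := hd.triangle x₀ ((g ^ m) x₀) ((g ^ (m + n)) x₀)
    rw [pow_add, IsometryEquiv.mul_apply, hd.map] at this
    simpa only [pow_add, IsometryEquiv.mul_apply] using this
  have hlim := hsub.tendsto_lim ⟨0, by
    rintro _ ⟨n, rfl⟩
    exact div_nonneg (hd.nonneg _ _) n.cast_nonneg⟩
  refine ⟨hsub.lim, fun y => ?_⟩
  have hz : Tendsto (fun n : ℕ => 2 * d x₀ y / (n : ℝ)) atTop (𝓝 0) :=
    tendsto_const_div_atTop_nhds_zero_nat _
  refine tendsto_of_tendsto_of_tendsto_of_le_of_le (by simpa using hlim.sub hz)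
    (by simpa using hlim.add hz) (fun n => ?_) (fun n => ?_)
  · change _ / (n : ℝ) - _ / (n : ℝ) ≤ _ / (n : ℝ)
    rw [← sub_div]
    have := hd.dist_orbit_le (g ^ n) y x₀
    rw [hd.comm y x₀] at this
    gcongr
    linarith
  · change _ / (n : ℝ) ≤ _ / (n : ℝ) + _ / (n : ℝ)
    rw [← add_div]
    have := hd.dist_orbit_le (g ^ n) x₀ y
    gcongr

/-- Linear growth along one orbit makes an isometry loxodromic. -/
theorem isLoxodromic_of_le (hd : IsInvariantDist d) {g : X ≃ᵢ X} {x : X} {a b : ℝ} (ha : 0 < a)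
    (h : ∀ n : ℕ, a * n - b ≤ d x ((g ^ n) x)) : IsLoxodromic d g := by
  obtain ⟨t, ht⟩ := hd.exists_isTranslationLength g
  refine ⟨t, ha.trans_le ?_, ht⟩
  have hz : Tendsto (fun n : ℕ => a - b / (n : ℝ)) atTop (𝓝 (a - 0)) :=
    tendsto_const_nhds.sub (tendsto_const_div_atTop_nhds_zero_nat _)
  rw [sub_zero] at hz
  refine le_of_tendsto_of_tendsto hz (ht x) ?_
  filter_upwards [eventually_gt_atTop 0] with n hn
  have hn' : (0 : ℝ) < n := by exact_mod_cast hn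
  rw [le_div_iff₀ hn', sub_mul, div_mul_cancel₀ _ hn'.ne']
  exact h n

theorem isElliptic_of_orbitBounded (hd : IsInvariantDist d) {g : X ≃ᵢ X} {x : X}
    (h : OrbitBounded d g x) : IsElliptic d g := by
  obtain ⟨R, hR⟩ := h
  refine fun y => ⟨R + 2 * d x y, fun m n => ?_⟩
  have h1 := hd.triangle ((g ^ m) y) ((g ^ m) x) ((g ^ n) y)
  have h2 := hd.triangle ((g ^ m) x) ((g ^ n) x) ((g ^ n) y)
  rw [hd.map, hd.comm y x] at h1
  rw [hd.map (g ^ n)] at h2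
  linarith [hR m n]

theorem mul_le_of_isTranslationLength (hd : IsInvariantDist d) {g : X ≃ᵢ X} {t : ℝ}
    (ht : IsTranslationLength d g t) (x : X) (n : ℕ) : n * t ≤ d x ((g ^ n) x) := by
  rcases Nat.eq_zero_or_pos n with rfl | hn
  · simpa using hd.nonneg _ _
  have hk : ∀ k : ℕ, d x (((g ^ n) ^ k) x) ≤ k * d x ((g ^ n) x) := by
    intro k
    induction k with
    | zero => simp [hd.self]
    | succ k ih =>
      have := hd.triangle x (((g ^ n) ^ k) x) (((g ^ n) ^ (k + 1)) x)
      rw [pow_succ, IsometryEquiv.mul_apply, hd.map] at this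
      rw [pow_succ, IsometryEquiv.mul_apply]
      push_cast
      linarith
  have hn' : (0 : ℝ) < n := by exact_mod_cast hn
  have hlim : Tendsto (fun k : ℕ => d x ((g ^ (n * k)) x) / ((n * k : ℕ) : ℝ)) atTop (𝓝 t) :=
    (ht x).comp (tendsto_id.const_mul_atTop' hn)
  rw [mul_comm, ← le_div_iff₀ hn']
  refine le_of_tendsto hlim ?_
  filter_upwards [eventually_gt_atTop 0] with k hk0
  have hk' : (0 : ℝ) < k := by exact_mod_cast hk0
  rw [pow_mul, div_le_div_iff₀ (by positivity) hn']
  have := mul_le_mul_of_nonneg_right (hk k) hn'.le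
  push_cast
  linarith

end IsInvariantDist

theorem IsLoxodromic.not_isElliptic {d : X → X → ℝ} {g : X ≃ᵢ X} (x : X)
    (h : IsLoxodromic d g) : ¬ IsElliptic d g := by
  intro he
  obtain ⟨t, ht0, ht⟩ := h
  obtain ⟨R, hR⟩ := he x
  have hz : Tendsto (fun n : ℕ => R / (n : ℝ)) atTop (𝓝 0) :=
    tendsto_const_div_atTop_nhds_zero_nat _
  refine absurd (le_of_tendsto_of_tendsto' (ht x) hz fun n => ?_) ht0.not_ge
  have := hR 0 n
  rw [zpow_zero, zpow_natCast] at this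
  gcongr
  exact this

theorem IsElliptic.not_isParabolic {d : X → X → ℝ} {g : X ≃ᵢ X} (h : IsElliptic d g) :
    ¬ IsParabolic d g := fun hp => hp.2.elim fun x hx => hx (h x)

theorem IsLoxodromic.not_isParabolic {d : X → X → ℝ} {g : X ≃ᵢ X} (x : X)
    (h : IsLoxodromic d g) : ¬ IsParabolic d g := fun hp => by
  obtain ⟨t, ht0, ht⟩ := h
  exact ht0.ne' (tendsto_nhds_unique (ht x) (hp.1 x))

/-! ### Curtains dual to a geodesic -/

namespace Geodesic

variable (β : Geodesic X)

/-- The curtain dual to `β` with pole centred at `r`. -/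
def curtain (r : ℝ) (hr : Set.Icc (r - 1 / 2) (r + 1 / 2) ⊆ interior β.I) : Curtain X where
  I := β.I
  α := β.α
  r := r
  ordConnected := β.ordConnected
  isClosed := β.isClosed
  isGeodesic := β.isGeodesic
  pole_subset := hr

theorem coord_curtain {r : ℝ} (hr : Set.Icc (r - 1 / 2) (r + 1 / 2) ⊆ interior β.I) (x : X) :
    (β.curtain r hr).coord x = β.param x - r := rfl

/-- A piece of a geodesic of length greater than `N` carries a chain of `N` dual curtains. -/
theorem exists_dual_chain {a b : ℝ} {N : ℕ} (hN : N < b - a) (hI : Set.Ioo a b ⊆ β.I) :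
    ∃ (r : Fin N → ℝ) (c : Fin N → Curtain X), IsOrdered c ∧ (∀ i, a ≤ r i ∧ r i ≤ b) ∧
      ∀ i x, (c i).coord x = β.param x - r i := by
  rcases Nat.eq_zero_or_pos N with rfl | hpos
  · exact ⟨fun i => i.elim0, fun i => i.elim0, fun i => i.elim0, fun i => i.elim0,
      fun i => i.elim0⟩
  have hN' : (0 : ℝ) < N := by exact_mod_cast hpos
  -- the poles are centred in `N` consecutive intervals of equal length `δ > 1`
  set δ : ℝ := (b - a) / N with hδ
  have hδ1 : 1 < δ := by rwa [hδ, one_lt_div hN']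
  have hδN : N * δ = b - a := by rw [hδ]; field_simp
  have hi : ∀ i : Fin N, ((i : ℕ) : ℝ) + 1 ≤ N := fun i => by exact_mod_cast i.2
  have hbd : ∀ i : Fin N, a + δ / 2 ≤ a + ((i : ℕ) + 1 / 2) * δ ∧
      a + ((i : ℕ) + 1 / 2) * δ ≤ b - δ / 2 := by
    intro i
    have h1 : (0 : ℝ) ≤ (i : ℕ) * δ := by positivity
    have h2 : ((i : ℕ) + 1) * δ ≤ N * δ := mul_le_mul_of_nonneg_right (hi i) (by linarith)
    constructor <;> linarith
  have hpole : ∀ i : Fin N, Set.Icc (a + ((i : ℕ) + 1 / 2) * δ - 1 / 2)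
      (a + ((i : ℕ) + 1 / 2) * δ + 1 / 2) ⊆ interior β.I := by
    intro i t ht
    refine interior_maximal hI isOpen_Ioo ⟨?_, ?_⟩
    · linarith [ht.1, (hbd i).1]
    · linarith [ht.2, (hbd i).2]
  refine ⟨fun i => a + ((i : ℕ) + 1 / 2) * δ, fun i => β.curtain _ (hpole i), ?_, fun i => ?_,
    fun i x => rfl⟩
  · intro i j hij z hz
    rw [coord_curtain] at hz ⊢
    have : ((i : ℕ) : ℝ) + 1 ≤ (j : ℕ) := by exact_mod_cast hij
    have := mul_le_mul_of_nonneg_right this (by linarith : (0 : ℝ) ≤ δ)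
    linarith
  · constructor <;> linarith [(hbd i).1, (hbd i).2]

end Geodesic

/-- Two `L`-separated curtains cannot both cross a piece of a geodesic of length more than
`L + 1`: otherwise they would both meet `L + 1` curtains dual to that piece. -/
theorem LSeparated.width_le (hX : IsCAT0 X) {L : ℕ} {h k : Curtain X} (H : LSeparated L h k)
    (β : Geodesic X) {a b : ℝ} (hI : Set.Ioo a b ⊆ β.I)
    (hx : ∃ x ∈ h.carrier, β.param x ≤ a) (hy : ∃ y ∈ h.carrier, b ≤ β.param y)
    (hx' : ∃ x ∈ k.carrier, β.param x ≤ a) (hy' : ∃ y ∈ k.carrier, b ≤ β.param y) :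
    b - a ≤ L + 1 := by
  by_contra! hlt
  obtain ⟨r, c, hc, hr, hcr⟩ := β.exists_dual_chain (N := L + 1) (by exact_mod_cast hlt) hI
  have meets : ∀ (l : Curtain X), (∃ x ∈ l.carrier, β.param x ≤ a) →
      (∃ y ∈ l.carrier, b ≤ β.param y) → ∀ i, ((c i).carrier ∩ l.carrier).Nonempty := by
    rintro l ⟨x, hx, hxa⟩ ⟨y, hy, hyb⟩ i
    obtain ⟨z, hz, hz0⟩ := (l.isPreconnected_carrier hX).intermediate_value hx hy
      (β.param_continuous hX).continuousOn ⟨hxa.trans (hr i).1, (hr i).2.trans hyb⟩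
    refine ⟨z, (mem_carrier _ hX).2 ?_, hz⟩
    rw [hcr, hz0]
    constructor <;> linarith
  have := H.2 (L + 1) c (hc.isChain hX) fun i => ⟨meets h hx hy i, meets k hx' hy' i⟩
  omega

/-! ### From a long chain to a bottleneck -/

/-- Going backwards from its left end, a geodesic line that is crossed by an `L`-chain can cross
only the first `L + 3` members of this chain a second time. -/
theorem IsLChainFromTo.coord_lt_of_le (hX : IsCAT0 X) {β : Geodesic X} (hβ : β.I = Set.univ)
    {L n : ℕ} {c : Fin n → Curtain X} {s t : ℝ} (hst : s ≤ t)
    (hc : IsLChainFromTo L c (β.α s) (β.α t)) {i : Fin n} (hi : L + 3 ≤ (i : ℕ)) {r : ℝ}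
    (hr : r ≤ s) : (c i).coord (β.α r) < -(1 / 2) := by
  by_contra! hcon
  have hm : ∀ u, u ∈ β.I := fun u => by rw [hβ]; trivial
  obtain ⟨j, hj⟩ : ∃ j : Fin n, (j : ℕ) + 1 = i := ⟨⟨i - 1, by omega⟩, by simp; omega⟩
  have hji : j < i := Fin.lt_def.2 (by omega)
  have hp := hc.ordered j i hji
  have cont := fun k => (c k).coord_continuous hX
  have hj1 := hp.coord_gt hcon
  obtain ⟨r', hr', -, e1⟩ := β.exists_apply_eq (cont j) (hm r) (hm s) (c := 0)
    (Set.mem_uIcc.2 (Or.inr ⟨by linarith [hc.left j], by linarith⟩))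
  rw [Set.uIcc_of_le hr] at hr'
  obtain ⟨r'', hr'', -, e2⟩ := β.exists_apply_eq (cont i) (hm r) (hm r') (c := -(1 / 2))
    (Set.mem_uIcc.2 (Or.inr ⟨(hp _ (by linarith)).le, hcon⟩))
  rw [Set.uIcc_of_le hr'.1] at hr''
  have cross : ∀ k, ∃ y ∈ (c k).carrier, s ≤ β.param y := by
    intro k
    obtain ⟨u, hu, -, e⟩ := β.exists_apply_eq (cont k) (hm s) (hm t) (c := 0)
      (Set.mem_uIcc.2 (Or.inl ⟨by linarith [hc.left k], by linarith [hc.right k]⟩))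
    rw [Set.uIcc_of_le hst] at hu
    refine ⟨_, (mem_carrier _ hX).2 ?_, by rw [β.param_apply hX (hm u)]; exact hu.1⟩
    rw [e]; constructor <;> linarith
  -- `c i` and `c j` both meet the line before `r'` and after `s`, so `[r', s]` is short; it is also
  -- long, because the first `j` members of the chain separate its endpoints
  have w := (hc.separated j i hji.ne).width_le hX β (a := r') (b := s) (fun u _ => hm u)
    ⟨β.α r', (mem_carrier _ hX).2 (by rw [e1]; constructor <;> linarith),
      (β.param_apply hX (hm _)).le⟩ (cross j)
    ⟨β.α r'', (mem_carrier _ hX).2 (by rw [e2]; constructor <;> linarith),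
      by rw [β.param_apply hX (hm _)]; exact hr''.2⟩ (cross i)
  have hd := IsOrdered.card_le_dist hX (c := c ∘ Fin.castLE j.2.le)
    (hc.ordered.comp (Fin.strictMono_castLE j.2.le)) (x := β.α s) (y := β.α r')
    (fun k => (hc.left _).le)
    fun k => ((hc.ordered (Fin.castLE j.2.le k) j
      (Fin.lt_def.2 k.2)).coord_gt (by rw [e1]; norm_num)).le
  rw [β.isGeodesic _ (hm _) _ (hm _), abs_of_nonneg (by linarith [hr'.2])] at hd
  have h3 : (L : ℝ) + 2 ≤ (j : ℕ) := by
    have : L + 2 ≤ (j : ℕ) := by omega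
    exact_mod_cast this
  linarith

/-- Going forwards from its right end, a geodesic line that is crossed by an `L`-chain can cross
only the last `L + 3` members of this chain a second time. -/
theorem IsLChainFromTo.coord_gt_of_ge (hX : IsCAT0 X) {β : Geodesic X} (hβ : β.I = Set.univ)
    {L n : ℕ} {c : Fin n → Curtain X} {s t : ℝ} (hst : s ≤ t)
    (hc : IsLChainFromTo L c (β.α s) (β.α t)) {i : Fin n} (hi : (i : ℕ) + L + 4 ≤ n) {r : ℝ}
    (hr : t ≤ r) : 1 / 2 < (c i).coord (β.α r) := by
  have hc' : IsLChainFromTo L (fun i => (c i.rev).flip) (β.reverse.α (-t)) (β.reverse.α (-s)) := by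
    change IsLChainFromTo L _ (β.α (- -t)) (β.α (- -s))
    rw [neg_neg, neg_neg]
    exact hc.reverse hX
  have := hc'.coord_lt_of_le hX (β := β.reverse)
    (by change Neg.neg ⁻¹' β.I = _; rw [hβ]; rfl) (neg_le_neg hst) (i := i.rev)
    (by rw [Fin.val_rev]; omega) (neg_le_neg hr)
  rw [coord_flip _ hX, Fin.rev_rev, show β.reverse.α (-r) = β.α (- -r) from rfl, neg_neg] at this
  linarith

/-- If `h₀` precedes `h₁` and both are crossed by a line between the parameters `s` and `t`, and
if `h₀` is not crossed to the left of `s`, then every point projecting far to the left of `s`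
lies in `h₁⁻`: the geodesic from its projection would otherwise cross both `h₀` and `h₁`. -/
theorem LSeparated.coord_lt_of_param_le (hX : IsCAT0 X) {β : Geodesic X} (hβ : β.I = Set.univ)
    {L : ℕ} {h₀ h₁ : Curtain X} (H : LSeparated L h₀ h₁) (hp : Prec h₀ h₁) {s t : ℝ} (hst : s ≤ t)
    (hs : ∀ r ≤ s, h₀.coord (β.α r) < -(1 / 2)) (ht : 1 / 2 < h₁.coord (β.α t)) {u : X}
    (hu : β.param u ≤ s - (L + 2)) : h₁.coord u < -(1 / 2) := by
  by_contra! hcon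
  have hm : ∀ u, u ∈ β.I := fun u => by rw [hβ]; trivial
  have hr : β.param u ≤ s := by linarith [(Nat.cast_nonneg L : (0 : ℝ) ≤ L)]
  have left : ∀ k : Curtain X, k.coord (β.α (β.param u)) < -(1 / 2) → -(1 / 2) ≤ k.coord u →
      ∃ x ∈ k.carrier, β.param x ≤ β.param u := by
    intro k hk1 hk2
    obtain ⟨z, hz, e⟩ := hX.exists_mem_between (k.coord_continuous hX) hk1.le hk2
    rw [between_comm] at hz
    exact ⟨z, (mem_carrier _ hX).2 (by rw [e]; constructor <;> linarith),
      (β.param_eq_of_mem_between hX hz).le⟩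
  have right : ∀ k : Curtain X, k.coord (β.α s) < -(1 / 2) → 1 / 2 < k.coord (β.α t) →
      ∃ y ∈ k.carrier, s ≤ β.param y := by
    intro k hk1 hk2
    obtain ⟨v, hv, -, e⟩ := β.exists_apply_eq (k.coord_continuous hX) (hm s) (hm t) (c := 0)
      (Set.mem_uIcc.2 (Or.inl ⟨by linarith, by linarith⟩))
    rw [Set.uIcc_of_le hst] at hv
    refine ⟨_, (mem_carrier _ hX).2 ?_, by rw [β.param_apply hX (hm v)]; exact hv.1⟩
    rw [e]; constructor <;> linarith
  have h1 : ∀ r ≤ s, h₁.coord (β.α r) < -(1 / 2) := fun r hr => hp _ (by linarith [hs r hr])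
  have w := H.width_le hX β (a := β.param u) (b := s) (fun u _ => hm u)
    (left h₀ (hs _ hr) (by linarith [hp.coord_gt hcon]))
    (right h₀ (hs s le_rfl) (hp.coord_gt (by linarith)))
    (left h₁ (h1 _ hr) hcon) (right h₁ (h1 s le_rfl) ht)
  linarith

/-- The piece `[a, b]` of the geodesic `β` is an `L`-bottleneck: at most `L` members of a chain
can all reach from the points that project to the left of `a` to those that project to the right
of `b`. -/
def Geodesic.IsBottleneck (β : Geodesic X) (L : ℕ) (a b : ℝ) : Prop :=
  ∀ (n : ℕ) (c : Fin n → Curtain X), IsChain c →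
    (∀ i, (∃ x ∈ (c i).carrier, β.param x ≤ a) ∧ ∃ y ∈ (c i).carrier, b ≤ β.param y) → n ≤ L

theorem Geodesic.IsBottleneck.mono {β : Geodesic X} {L : ℕ} {a b a' b' : ℝ}
    (h : β.IsBottleneck L a b) (ha : a' ≤ a) (hb : b ≤ b') : β.IsBottleneck L a' b' :=
  fun n c hc hm => h n c hc fun i => ⟨(hm i).1.imp fun _ hx => ⟨hx.1, hx.2.trans ha⟩,
    (hm i).2.imp fun _ hx => ⟨hx.1, hb.trans hx.2⟩⟩

/-- A line crossed by a long `L`-chain has a bottleneck: four consecutive members of the chain are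
crossed only once, and all points projecting far to the left or far to the right are separated
by the two middle ones. -/
theorem IsLChainFromTo.isBottleneck (hX : IsCAT0 X) {β : Geodesic X} (hβ : β.I = Set.univ)
    {L n : ℕ} {c : Fin n → Curtain X} {s t : ℝ} (hst : s ≤ t)
    (hc : IsLChainFromTo L c (β.α s) (β.α t)) (hn : 2 * L + 10 ≤ n) :
    β.IsBottleneck L (s - (L + 2)) (t + (L + 2)) := by
  set i₀ : Fin n := ⟨L + 3, by omega⟩
  set i₁ : Fin n := ⟨L + 4, by omega⟩
  set i₂ : Fin n := ⟨L + 5, by omega⟩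
  set i₃ : Fin n := ⟨L + 6, by omega⟩
  have h01 : i₀ < i₁ := Fin.lt_def.2 (by simp [i₀, i₁])
  have h12 : i₁ < i₂ := Fin.lt_def.2 (by simp [i₁, i₂])
  have h23 : i₂ < i₃ := Fin.lt_def.2 (by simp [i₂, i₃])
  have hleft : ∀ u, β.param u ≤ s - (L + 2) → (c i₁).coord u < -(1 / 2) := fun u hu =>
    (hc.separated i₀ i₁ h01.ne).coord_lt_of_param_le hX hβ (hc.ordered _ _ h01) hst
      (fun r hr => hc.coord_lt_of_le hX hβ hst (by simp [i₀]) hr) (hc.right i₁) hu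
  have hright : ∀ u, t + (L + 2) ≤ β.param u → 1 / 2 < (c i₂).coord u := by
    intro u hu
    have := ((hc.separated i₃ i₂ h23.ne').congr (carrier_flip hX)
      (carrier_flip hX)).coord_lt_of_param_le hX (β := β.reverse)
      (by change Neg.neg ⁻¹' β.I = _; rw [hβ]; rfl) ((hc.ordered _ _ h23).flip hX)
      (neg_le_neg hst) ?_ ?_ (u := u) ?_
    · rw [coord_flip _ hX] at this; linarith
    · intro r hr
      rw [coord_flip _ hX]
      have := hc.coord_gt_of_ge hX hβ hst (i := i₃) (by simp [i₃]; omega) (r := -r) (by linarith)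
      change -((c i₃).coord (β.α (-r))) < _
      linarith
    · rw [coord_flip _ hX, show β.reverse.α (-s) = β.α (- -s) from rfl, neg_neg]
      linarith [hc.left i₂]
    · rw [β.param_reverse hX]; linarith
  intro m d hd hmeet
  refine (hc.separated i₁ i₂ h12.ne).2 m d hd fun i => ?_
  obtain ⟨⟨x, hx, hxa⟩, ⟨y, hy, hyb⟩⟩ := hmeet i
  have hx1 := hleft x hxa
  have hy2 := hright y hyb
  have hx2 := hc.ordered _ _ h12 x (by linarith)
  have hy1 := (hc.ordered _ _ h12).coord_gt (z := y) (by linarith)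
  have cross : ∀ k : Curtain X, k.coord x < -(1 / 2) → 1 / 2 < k.coord y →
      ((d i).carrier ∩ k.carrier).Nonempty := by
    intro k hk1 hk2
    obtain ⟨z, hz, e⟩ := ((d i).isPreconnected_carrier hX).intermediate_value hx hy
      (k.coord_continuous hX).continuousOn (Set.mem_Icc.2 ⟨hk1.le, by linarith⟩)
    exact ⟨z, hz, (mem_carrier _ hX).2 (by rw [e]; constructor <;> linarith)⟩
  exact ⟨cross _ hx1 hy1, cross _ hx2 hy2⟩

/-- The line `β` is an axis of `g`, with translation length `τ`. -/
structure IsAxis (g : X ≃ᵢ X) (β : Geodesic X) (τ : ℝ) : Prop where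
  pos : 0 < τ
  univ : β.I = Set.univ
  apply_α : ∀ t, g (β.α t) = β.α (t + τ)

namespace IsAxis

variable {g : X ≃ᵢ X} {β : Geodesic X} {τ : ℝ}

theorem mem (h : IsAxis g β τ) (t : ℝ) : t ∈ β.I := by rw [h.univ]; trivial

theorem dist_α (h : IsAxis g β τ) (s t : ℝ) : dist (β.α s) (β.α t) = |s - t| :=
  β.isGeodesic s (h.mem s) t (h.mem t)

theorem zpow_apply (h : IsAxis g β τ) (k : ℤ) (t : ℝ) : (g ^ k) (β.α t) = β.α (t + k * τ) := by
  induction k generalizing t with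
  | zero => simp
  | succ k ih =>
    rw [zpow_add_one, IsometryEquiv.mul_apply, h.apply_α, ih]
    push_cast; ring_nf
  | pred k ih =>
    have hinv : (g⁻¹ : X ≃ᵢ X) (β.α t) = β.α (t - τ) := by
      apply g.injective
      rw [h.apply_α, sub_add_cancel, ← IsometryEquiv.mul_apply, mul_inv_cancel]; rfl
    rw [zpow_sub_one, IsometryEquiv.mul_apply, hinv, ih]
    push_cast; ring_nf

theorem param_zpow (hX : IsCAT0 X) (h : IsAxis g β τ) (k : ℤ) (x : X) :
    β.param ((g ^ k) x) = β.param x + k * τ := by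
  refine β.param_eq_of_closest hX (h.mem _) fun s _ => ?_
  have e : β.α s = (g ^ k) (β.α (s - k * τ)) := by rw [h.zpow_apply]; ring_nf
  rw [← h.zpow_apply, e, (g ^ k).dist_eq, (g ^ k).dist_eq]
  exact β.dist_param_le x (h.mem _)

/-- The translates of a bottleneck are bottlenecks. -/
theorem isBottleneck_add (hX : IsCAT0 X) (h : IsAxis g β τ) {L : ℕ} {a b : ℝ}
    (hb : β.IsBottleneck L a b) (k : ℤ) : β.IsBottleneck L (a + k * τ) (b + k * τ) := by
  intro n c hc hm
  refine hb n _ (hc.map hX (g ^ (-k))) fun i => ?_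
  obtain ⟨⟨x, hx, hxa⟩, ⟨y, hy, hyb⟩⟩ := hm i
  refine ⟨⟨_, (carrier_map hX _ _).2 hx, ?_⟩, ⟨_, (carrier_map hX _ _).2 hy, ?_⟩⟩ <;>
  · rw [h.param_zpow hX]; push_cast; linarith

theorem exists_forall_isBottleneck (hX : IsCAT0 X) (h : IsAxis g β τ) {L : ℕ} {a b : ℝ}
    (hb : β.IsBottleneck L a b) : ∃ W, 0 ≤ W ∧ ∀ a', β.IsBottleneck L a' (a' + W) := by
  refine ⟨max 0 (b - a + τ), le_max_left _ _, fun a' => ?_⟩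
  refine (h.isBottleneck_add hX hb ⌈(a' - a) / τ⌉).mono ?_ ?_
  · have := (div_le_iff₀ h.pos).1 (Int.le_ceil ((a' - a) / τ))
    linarith
  · have := (Int.ceil_lt_add_one ((a' - a) / τ)).le
    have := mul_le_mul_of_nonneg_right this h.pos.le
    rw [add_mul, div_mul_cancel₀ _ h.pos.ne'] at this
    linarith [le_max_right 0 (b - a + τ)]

end IsAxis

/-! ### From bottlenecks to contraction -/

/-- A geodesic whose endpoints project to far apart points of a line with bottlenecks passes close
to this line. Otherwise the perpendicular from an intermediate point `p` to the line carries
`L + 1` dual curtains. One of the two halves of the geodesic projects to `p` on this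
perpendicular, and the line projects to its foot; so each of these curtains meets the preimages,
under the projection to the line, of two points that are far apart. -/
theorem Geodesic.dist_le_of_isBottleneck (hX : IsCAT0 X) {β : Geodesic X} (hβ : β.I = Set.univ)
    {L : ℕ} {W : ℝ} (hW : ∀ a, β.IsBottleneck L a (a + W)) {x y p : X} (hp : p ∈ between x y)
    (hx : β.param x ≤ β.param p - W) (hy : β.param p + W ≤ β.param y) (hW0 : 0 ≤ W) :
    dist p (β.α (β.param p)) ≤ L + 1 := by
  by_contra! hcon
  have hm : ∀ u, u ∈ β.I := fun u => by rw [hβ]; trivial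
  obtain ⟨γ, hI, h0, h1⟩ := hX.exists_segment p (β.α (β.param p))
  set D := dist p (β.α (β.param p)) with hD
  have hD0 : 0 ≤ D := dist_nonneg
  have h0I : (0 : ℝ) ∈ γ.I := by rw [hI]; exact ⟨le_rfl, hD0⟩
  have h1I : D ∈ γ.I := by rw [hI]; exact ⟨hD0, le_rfl⟩
  obtain ⟨r, c, hc, hr, hcr⟩ := γ.exists_dual_chain (N := L + 1) (a := 0) (b := D)
    (by push_cast; linarith) (by rw [hI]; exact Set.Ioo_subset_Icc_self)
  have hparam : ∀ s ∈ γ.I, β.param (γ.α s) = β.param p := by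
    intro s hs
    have hs' := hs
    rw [hI] at hs'
    refine β.param_eq_of_mem_between hX ?_
    have e1 := γ.isGeodesic 0 h0I s hs
    have e2 := γ.isGeodesic s hs D h1I
    rw [h0, abs_of_nonpos (by linarith [hs'.1])] at e1
    rw [h1, abs_of_nonpos (by linarith [hs'.2])] at e2
    rw [mem_between, e1, e2]; ring
  have hline : ∀ m, γ.param (β.α m) = D := by
    intro m
    refine γ.param_eq_of_closest hX h1I fun s hs => ?_
    have ho := β.param_obtuse hX (γ.α s) (hm m)
    rw [hparam s hs] at ho
    rw [h1, β.isGeodesic _ (hm _) _ (hm _), abs_sub_comm]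
    refine abs_le_of_sq_le_sq ?_ dist_nonneg
    rw [dist_comm _ (γ.α s)]
    nlinarith [sq_nonneg (dist (γ.α s) (β.α (β.param p)))]
  have meets : ∀ z, γ.param z = 0 → ∀ i, ∃ w ∈ (c i).carrier, β.param w = β.param z := by
    intro z hz i
    obtain ⟨w, hw, e⟩ := (β.isPreconnected_preimage hX
      (Set.ordConnected_singleton (a := β.param z))).intermediate_value (a := z)
      (b := β.α (β.param z)) rfl (β.param_apply hX (hm _)) (γ.param_continuous hX).continuousOn
      (show r i ∈ _ by rw [hz, hline]; exact Set.mem_Icc.2 (hr i))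
    refine ⟨w, (mem_carrier _ hX).2 ?_, hw⟩
    rw [hcr, e]; constructor <;> linarith
  have mp := meets p (by rw [← h0]; exact γ.param_apply hX h0I)
  have contra : ∀ a, ¬ (∀ i, (∃ w ∈ (c i).carrier, β.param w ≤ a) ∧
      ∃ w ∈ (c i).carrier, a + W ≤ β.param w) := by
    intro a ha
    have := hW a (L + 1) c (hc.isChain hX) ha
    omega
  have hp' : γ.α 0 ∈ between x y := by rwa [h0]
  rcases γ.param_eq_zero_or hX hI hD0 hp' with e | e
  · obtain ⟨z, hz, hz0⟩ := hX.exists_mem_between (β.param_continuous hX) (x := x) (y := p) hx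
      (by linarith)
    have ez : γ.param z = 0 := by
      rw [γ.param_eq_of_mem_between hX (x := x) (by rwa [e, h0]), e]
    refine contra (β.param p - W) fun i => ⟨?_, ?_⟩
    · exact (meets z ez i).imp fun w hw => ⟨hw.1, by linarith [hw.2]⟩
    · exact (mp i).imp fun w hw => ⟨hw.1, by linarith [hw.2]⟩
  · obtain ⟨z, hz, hz0⟩ := hX.exists_mem_between (β.param_continuous hX) (x := p) (y := y)
      (c := β.param p + W) (by linarith) hy
    rw [between_comm] at hz
    have ez : γ.param z = 0 := by
      rw [γ.param_eq_of_mem_between hX (x := y) (by rwa [e, h0]), e]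
    refine contra (β.param p) fun i => ⟨?_, ?_⟩
    · exact (mp i).imp fun w hw => ⟨hw.1, by linarith [hw.2]⟩
    · exact (meets z ez i).imp fun w hw => ⟨hw.1, by linarith [hw.2]⟩

namespace IsAxis

variable {g : X ≃ᵢ X} {β : Geodesic X} {τ : ℝ}

theorem isQIEmbedding (h : IsAxis g β τ) : IsQIEmbedding fun n : ℤ => (g ^ n) (β.α 0) := by
  have hpos := h.pos
  refine ⟨1 + τ + 1 / τ, 0, by have := one_div_pos.2 hpos; linarith, le_rfl, fun m n => ?_⟩
  have hd : dist ((g ^ m) (β.α 0)) ((g ^ n) (β.α 0)) = |(m : ℝ) - n| * τ := by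
    rw [h.zpow_apply, h.zpow_apply, h.dist_α,
      show (0 : ℝ) + m * τ - (0 + n * τ) = (m - n) * τ by ring, abs_mul, abs_of_pos hpos]
  have hinv := one_div_pos.2 hpos
  rw [hd, sub_zero, add_zero, div_le_iff₀ (by positivity)]
  have h1 : τ * (1 / τ) = 1 := by field_simp
  have h2 : 0 ≤ |(m : ℝ) - n| := abs_nonneg _
  constructor
  · have : 1 ≤ τ * (1 + τ + 1 / τ) := by nlinarith
    nlinarith
  · nlinarith [mul_nonneg h2 hinv.le]

/-- The points of an orbit on the axis that are closest to `x` are close to the projection of `x`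
to the axis. -/
theorem abs_param_sub_le_of_closest (hX : IsCAT0 X) (h : IsAxis g β τ) {x a : X}
    (ha : a ∈ closestPoints (Set.range fun n : ℤ => (g ^ n) (β.α 0)) x) :
    |β.param x - β.param a| ≤ τ := by
  obtain ⟨⟨n, rfl⟩, hmin⟩ := ha
  have hpos := h.pos
  have hα : ∀ k : ℤ, (g ^ k) (β.α 0) = β.α (k * τ) := fun k => by rw [h.zpow_apply, zero_add]
  have hmin' : ∀ k : ℤ, dist x (β.α (n * τ)) ≤ dist x (β.α (k * τ)) := fun k => by
    have := hmin _ ⟨k, rfl⟩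
    simpa only [hα] using this
  simp only [hα]
  rw [β.param_apply hX (h.mem _)]
  by_contra! hlt
  -- the neighbouring orbit point in the direction of the projection would be strictly closer
  have step : ∀ ε : ℤ, (β.param x - n * τ) = ε * |β.param x - n * τ| → False := by
    intro ε hε
    set m := β.param x
    have hpos' : 0 < |m - n * τ| := by linarith
    have hne : (n : ℝ) * τ ≠ m := by
      intro e; rw [e, sub_self, abs_zero] at hlt; linarith
    have hlt' := β.dist_lt_dist hX x (t := n * τ) (θ := 1 - τ / |m - n * τ|) (h.mem _) hne
      (by rw [sub_nonneg, div_le_one hpos']; exact hlt.le) (by have := div_pos hpos hpos'; linarith)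
    have e : (1 - (1 - τ / |m - n * τ|)) * m + (1 - τ / |m - n * τ|) * (n * τ)
        = ((n + ε : ℤ) : ℝ) * τ := by
      have : τ / |m - n * τ| * (m - n * τ) = ε * τ := by
        rw [div_mul_eq_mul_div, div_eq_iff hpos'.ne']
        linear_combination τ * hε
      push_cast
      linear_combination this
    rw [e] at hlt'
    exact absurd (hmin' _) hlt'.not_ge
  rcases le_total 0 (β.param x - n * τ) with h0 | h0
  · exact step 1 (by rw [abs_of_nonneg h0]; simp)
  · exact step (-1) (by rw [abs_of_nonpos h0]; simp)

/-- An isometry whose axis has a bottleneck is contracting. -/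
theorem isContracting (hX : IsCAT0 X) (h : IsAxis g β τ) {L : ℕ} {a b : ℝ}
    (hb : β.IsBottleneck L a b) : IsContracting g := by
  obtain ⟨W, hW0, hW⟩ := h.exists_forall_isBottleneck hX hb
  have hpos := h.pos
  have hL : (0 : ℝ) ≤ L := Nat.cast_nonneg L
  -- the geodesic from the centre to a point with a distant projection comes close to the axis
  have key : ∀ z b, dist z b < dist z (β.α (β.param z)) + τ →
      |β.param z - β.param b| ≤ 2 * W + L + 1 + τ := by
    intro z b hzb
    by_contra! hlt
    have fin : ∀ p ∈ between z b, dist p (β.α (β.param p)) ≤ L + 1 →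
        |β.param z - β.param b| ≤ |β.param p - β.param b| + W → False := by
      intro p hp hd hab
      have h1 := β.dist_param_le z (h.mem (β.param p))
      have h2 := dist_triangle z p (β.α (β.param p))
      have h3 := β.abs_param_sub_le hX p b
      rw [mem_between] at hp
      linarith
    rcases le_total (β.param z) (β.param b) with hle | hle
    · rw [abs_of_nonpos (by linarith)] at hlt fin
      obtain ⟨p, hp, e⟩ := hX.exists_mem_between (β.param_continuous hX) (x := z) (y := b)
        (c := β.param z + W) (by linarith) (by linarith)
      refine fin p hp (β.dist_le_of_isBottleneck hX h.univ hW hp (by linarith) (by linarith) hW0) ?_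
      rw [abs_of_nonpos (by linarith)]; linarith
    · rw [abs_of_nonneg (by linarith)] at hlt fin
      obtain ⟨p, hp, e⟩ := hX.exists_mem_between (β.param_continuous hX) (x := b) (y := z)
        (c := β.param z - W) (by linarith) (by linarith)
      refine fin p (by rwa [between_comm])
        (β.dist_le_of_isBottleneck hX h.univ hW hp (by linarith) (by linarith) hW0) ?_
      rw [abs_of_nonneg (by linarith)]; linarith
  refine ⟨β.α 0, h.isQIEmbedding, 2 * τ + 2 * (2 * W + L + 1 + τ), ?_⟩
  intro z ρ hdisj b hb b' hb' a ha a' ha'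
  have hρ : ρ ≤ dist z (β.α (β.param z)) + τ := by
    set n := ⌊β.param z / τ⌋
    have hn : (g ^ n) (β.α 0) ∉ Metric.ball z ρ := Set.disjoint_right.1 hdisj ⟨n, rfl⟩
    rw [Metric.mem_ball, not_lt, h.zpow_apply, zero_add, dist_comm] at hn
    have h1 := dist_triangle z (β.α (β.param z)) (β.α (n * τ))
    have h2 := (le_div_iff₀ hpos).1 (Int.floor_le (β.param z / τ))
    have h3 := (div_lt_iff₀ hpos).1 (Int.lt_floor_add_one (β.param z / τ))
    rw [h.dist_α, abs_of_nonneg (by linarith)] at h1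
    linarith
  rw [Metric.mem_ball, dist_comm] at hb hb'
  have k1 := key z b (by linarith)
  have k2 := key z b' (by linarith)
  have c1 := h.abs_param_sub_le_of_closest hX ha
  have c2 := h.abs_param_sub_le_of_closest hX ha'
  have e : dist a a' = |β.param a - β.param a'| := by
    obtain ⟨⟨n, rfl⟩, -⟩ := ha
    obtain ⟨⟨n', rfl⟩, -⟩ := ha'
    simp only [h.zpow_apply, h.dist_α, β.param_apply hX (h.mem _)]
  rw [e]
  rw [abs_le] at *
  constructor <;> linarith [k1.1, k1.2, k2.1, k2.2, c1.1, c1.2, c2.1, c2.2]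

theorem distL_le_of_not_isContracting (hX : IsCAT0 X) (h : IsAxis g β τ) (hg : ¬ IsContracting g)
    (L : ℕ) (s t : ℝ) : distL L (β.α s) (β.α t) ≤ 2 * L + 10 := by
  wlog hst : s ≤ t generalizing s t
  · rw [(isInvariantDist_distL hX L).comm]
    exact this t s (le_of_not_ge hst)
  rcases eq_or_ne (β.α s) (β.α t) with e | hne
  · rw [e, distL_self]; positivity
  obtain ⟨n, c, hc, e⟩ := exists_chain_distL hX L hne
  rw [e]
  by_contra! hlt
  refine hg (h.isContracting hX (hc.isBottleneck hX h.univ hst ?_))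
  have : ((2 * L + 9 : ℕ) : ℝ) < n := by push_cast; linarith
  have : 2 * L + 9 < n := by exact_mod_cast this
  omega

/-- The bounds for the distances `d_L` are linear in `L`, so their weighted sum converges. -/
theorem orbitBounded_distD (hX : IsCAT0 X) {w : ℕ+ → ℝ} (hw : IsCurtainWeight w)
    (h : IsAxis g β τ) (hg : ¬ IsContracting g) : OrbitBounded (distD w) g (β.α 0) := by
  have hsum : Summable fun L : ℕ+ => w L * (2 * (L : ℕ) + 10) := by
    refine Summable.of_nonneg_of_le
      (fun L => mul_nonneg (hw.mem_Ioo L).1.le (by positivity)) (fun L => ?_)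
      (hw.summable_sq.mul_left 12)
    have h1 : (1 : ℝ) ≤ (L : ℕ) := by exact_mod_cast L.pos
    have h2 : 2 * ((L : ℕ) : ℝ) + 10 ≤ 12 * ((L : ℕ) : ℝ) ^ 2 := by nlinarith
    have := mul_le_mul_of_nonneg_left h2 (hw.mem_Ioo L).1.le
    linarith
  refine ⟨_, fun m n => (summable_distD hX hw _ _).tsum_le_tsum (fun L => ?_) hsum⟩
  rw [h.zpow_apply, h.zpow_apply]
  exact mul_le_mul_of_nonneg_left (h.distL_le_of_not_isContracting hX hg L _ _)
    (hw.mem_Ioo L).1.le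

end IsAxis

/-! ### From contraction to bottlenecks -/

/-- Geodesics are unique: the metric interval between two points of a geodesic lies on it. -/
theorem Geodesic.exists_eq_of_mem_between (hX : IsCAT0 X) (β : Geodesic X) {s t : ℝ} (hs : s ∈ β.I)
    (ht : t ∈ β.I) {z : X} (hz : z ∈ between (β.α s) (β.α t)) :
    ∃ r ∈ Set.uIcc s t, r ∈ β.I ∧ z = β.α r := by
  rw [mem_between, β.isGeodesic s hs t ht] at hz
  have d1 := dist_nonneg (x := β.α s) (y := z)
  have d2 := dist_nonneg (x := z) (y := β.α t)
  rcases eq_or_ne s t with rfl | hne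
  · refine ⟨s, Set.left_mem_uIcc, hs, ?_⟩
    rw [sub_self, abs_zero] at hz
    exact (dist_le_zero.1 (by linarith)).symm
  · have hD : 0 < |s - t| := abs_pos.2 (sub_ne_zero.2 hne)
    set θ := dist (β.α s) z / |s - t| with hθ
    have e : θ * |s - t| = dist z (β.α s) := by rw [hθ, dist_comm z]; field_simp
    have e' : (1 - θ) * |s - t| = dist z (β.α t) := by rw [dist_comm] at e; linarith
    have h0 : 0 ≤ θ := by positivity
    have h1 : θ ≤ 1 := by rw [hθ, div_le_one hD]; linarith
    have hmem : (1 - θ) * s + θ * t ∈ Set.uIcc s t :=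
      convex_uIcc s t Set.left_mem_uIcc Set.right_mem_uIcc (by linarith) h0 (by ring)
    refine ⟨_, hmem, β.ordConnected.uIcc_subset hs ht hmem, ?_⟩
    have hst := β.stewart hX z hs ht h0 h1
    rw [← e, ← e', ← sq_abs (s - t)] at hst
    have : dist z (β.α ((1 - θ) * s + θ * t)) ^ 2 ≤ 0 := hst.trans (by nlinarith)
    exact dist_eq_zero.1 (pow_eq_zero_iff two_ne_zero |>.1 (le_antisymm this (sq_nonneg _)))

/-- A function that climbs from below `A` to above `B` does so on a subinterval on which it takes
its values between `A` and `B`. -/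
theorem exists_subinterval_crossing {φ : ℝ → ℝ} {ℓ A B : ℝ} (hφ : ContinuousOn φ (Set.Icc 0 ℓ))
    (hℓ : 0 ≤ ℓ) (h0 : φ 0 ≤ A) (h1 : B ≤ φ ℓ) (hAB : A < B) :
    ∃ s t, 0 ≤ s ∧ s ≤ t ∧ t ≤ ℓ ∧ φ s = A ∧ φ t = B ∧
      ∀ u ∈ Set.Icc s t, A ≤ φ u ∧ φ u ≤ B := by
  obtain ⟨t, ⟨ht, htB⟩, htmin⟩ := (isCompact_Icc.of_isClosed_subset
    (hφ.preimage_isClosed_of_isClosed isClosed_Icc (isClosed_Ici (a := B)))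
    Set.inter_subset_left).exists_isLeast ⟨ℓ, ⟨hℓ, le_rfl⟩, h1⟩
  have htB' : φ t = B := by
    obtain ⟨t', ht', e⟩ := intermediate_value_Icc ht.1
      (hφ.mono (Set.Icc_subset_Icc_right ht.2)) ⟨h0.trans hAB.le, htB⟩
    have := htmin ⟨⟨ht'.1, ht'.2.trans ht.2⟩, e.ge⟩
    rwa [le_antisymm ht'.2 this] at e
  have hφ' : ContinuousOn φ (Set.Icc 0 t) := hφ.mono (Set.Icc_subset_Icc_right ht.2)
  obtain ⟨s, ⟨hs, hsA⟩, hsmax⟩ := (isCompact_Icc.of_isClosed_subset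
    (hφ'.preimage_isClosed_of_isClosed isClosed_Icc (isClosed_Iic (a := A)))
    Set.inter_subset_left).exists_isGreatest ⟨0, ⟨le_rfl, ht.1⟩, h0⟩
  have hsA' : φ s = A := by
    obtain ⟨s', hs', e⟩ := intermediate_value_Icc hs.2
      (hφ'.mono (Set.Icc_subset_Icc_left hs.1)) ⟨hsA, by rw [htB']; exact hAB.le⟩
    have := hsmax ⟨⟨hs.1.trans hs'.1, hs'.2⟩, e.le⟩
    rwa [le_antisymm this hs'.1] at e
  refine ⟨s, t, hs.1, hs.2, ht.2, hsA', htB', fun u hu => ⟨?_, ?_⟩⟩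
  · by_contra! h
    have := hsmax ⟨⟨hs.1.trans hu.1, hu.2⟩, h.le⟩
    rw [le_antisymm this hu.1, hsA'] at h
    exact h.false
  · by_contra! h
    have := htmin ⟨⟨hs.1.trans hu.1, hu.2.trans ht.2⟩, h.le⟩
    rw [le_antisymm hu.2 this, htB'] at h
    exact h.false

/-- The geodesic `β` is `C`-contracting, in terms of its closest point projection. -/
def Geodesic.IsContracting (β : Geodesic X) (C : ℝ) : Prop :=
  ∀ p q, dist p q ≤ dist p (β.α (β.param p)) → |β.param p - β.param q| ≤ C

namespace Geodesic

variable {β : Geodesic X}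

/-- A geodesic that stays far from a contracting geodesic `β` has a small projection to it: the
projections of the two parts close to the endpoints are small by contraction, and along the middle
part, which is no longer than the projection of the whole, the projection moves at half speed. -/
theorem IsContracting.abs_param_sub_le {C : ℝ} (hC : β.IsContracting C) (hC1 : 1 ≤ C)
    {γ : Geodesic X} {s t : ℝ} (hst : s ≤ t) (hI : Set.Icc s t ⊆ γ.I)
    (hfar : ∀ r ∈ Set.Icc s t, 2 * C < dist (γ.α r) (β.α (β.param (γ.α r)))) :
    |β.param (γ.α s) - β.param (γ.α t)| ≤ 6 * C := by
  have hd : ∀ u v, s ≤ u → u ≤ v → v ≤ t → dist (γ.α u) (γ.α v) = v - u := by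
    intro u v hu huv hv
    rw [γ.isGeodesic u (hI ⟨hu, huv.trans hv⟩) v (hI ⟨hu.trans huv, hv⟩), abs_sub_comm,
      abs_of_nonneg (by linarith)]
  have steps : ∀ (n : ℕ) (u v : ℝ), s ≤ u → u ≤ v → v ≤ t → v - u ≤ 2 * C * n →
      |β.param (γ.α u) - β.param (γ.α v)| ≤ C * n := by
    intro n
    induction n with
    | zero =>
      intro u v _ huv _ h
      rw [Nat.cast_zero, mul_zero] at h
      rw [le_antisymm huv (by linarith)]; simp
    | succ n ih =>
      intro u v hu huv hv h
      push_cast at h ⊢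
      have hu' : u ≤ max u (v - 2 * C) := le_max_left _ _
      have hv' : max u (v - 2 * C) ≤ v := max_le huv (by linarith)
      have i1 := ih u (max u (v - 2 * C)) hu hu' (hv'.trans hv) (by
        rcases max_choice u (v - 2 * C) with e | e <;> rw [e]
        · rw [sub_self]; positivity
        · linarith)
      have i2 := hC (γ.α v) (γ.α (max u (v - 2 * C))) (by
        rw [dist_comm, hd _ _ (hu.trans hu') hv' hv]
        linarith [le_max_right u (v - 2 * C), hfar v ⟨hu.trans huv, hv⟩])
      have := abs_sub_le (β.param (γ.α u)) (β.param (γ.α (max u (v - 2 * C))))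
        (β.param (γ.α v))
      rw [abs_sub_comm] at i2
      linarith
  have half : ∀ u v, s ≤ u → u ≤ v → v ≤ t →
      |β.param (γ.α u) - β.param (γ.α v)| ≤ (v - u) / 2 + C := by
    intro u v hu huv hv
    have h2C : (0 : ℝ) < 2 * C := by linarith
    have h1 := (div_le_iff₀ h2C).1 (Nat.le_ceil ((v - u) / (2 * C)))
    have h2 := Nat.ceil_lt_add_one (div_nonneg (sub_nonneg.2 huv) h2C.le)
    have h3 := steps _ u v hu huv hv (by linarith)
    have h4 : (v - u) / (2 * C) * C = (v - u) / 2 := by field_simp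
    nlinarith
  set ρ := dist (γ.α s) (β.α (β.param (γ.α s))) with hρ
  set σ := dist (γ.α t) (β.α (β.param (γ.α t))) with hσ
  have hρ0 : 0 ≤ ρ := dist_nonneg
  have hσ0 : 0 ≤ σ := dist_nonneg
  have hlen : t - s ≤ ρ + |β.param (γ.α s) - β.param (γ.α t)| + σ := by
    rw [← hd s t le_rfl hst le_rfl, ← β.isGeodesic _ (β.param_mem _) _ (β.param_mem _), hρ, hσ,
      dist_comm (γ.α t) (β.α _)]
    exact dist_triangle4 _ _ _ _
  rcases le_total (t - s) (ρ + σ) with hcase | hcase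
  · have hm1 : s ≤ min t (s + ρ) := le_min hst (by linarith)
    have hm2 : min t (s + ρ) ≤ t := min_le_left _ _
    have i1 := hC (γ.α s) (γ.α (min t (s + ρ))) (by
      rw [hd _ _ le_rfl hm1 hm2]; linarith [min_le_right t (s + ρ)])
    have i2 := hC (γ.α t) (γ.α (min t (s + ρ))) (by
      rw [dist_comm, hd _ _ hm1 hm2 le_rfl]
      rcases min_choice t (s + ρ) with e | e <;> rw [e] <;> linarith)
    have := abs_sub_le (β.param (γ.α s)) (β.param (γ.α (min t (s + ρ)))) (β.param (γ.α t))
    rw [abs_sub_comm] at i2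
    linarith
  · have i1 := hC (γ.α s) (γ.α (s + ρ)) (by
      rw [hd _ _ le_rfl (by linarith) (by linarith)]; linarith)
    have i2 := hC (γ.α t) (γ.α (t - σ)) (by
      rw [dist_comm, hd _ _ (by linarith) (by linarith) le_rfl]; linarith)
    have i3 := half (s + ρ) (t - σ) (by linarith) (by linarith) (by linarith)
    have h1 := abs_sub_le (β.param (γ.α s)) (β.param (γ.α (s + ρ))) (β.param (γ.α t))
    have h2 := abs_sub_le (β.param (γ.α (s + ρ))) (β.param (γ.α (t - σ))) (β.param (γ.α t))
    rw [abs_sub_comm] at i2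
    linarith

/-- A geodesic with a large projection to a contracting geodesic passes close to it. -/
theorem IsContracting.exists_close (hX : IsCAT0 X) {C : ℝ} (hC : β.IsContracting C) (hC1 : 1 ≤ C)
    {u v : X} {A : ℝ} (hu : β.param u ≤ A) (hv : A + (6 * C + 1) ≤ β.param v) :
    ∃ z ∈ between u v, A ≤ β.param z ∧ β.param z ≤ A + (6 * C + 1) ∧
      dist z (β.α (β.param z)) ≤ 2 * C := by
  obtain ⟨γ, hI, h0, h1⟩ := hX.exists_segment u v
  have hd : 0 ≤ dist u v := dist_nonneg
  obtain ⟨s, t, hs, hst, ht, es, et, hmid⟩ := exists_subinterval_crossing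
    (φ := fun r => β.param (γ.α r)) (A := A) (B := A + (6 * C + 1))
    ((β.param_continuous hX).comp_continuousOn (hI ▸ γ.continuousOn)) hd
    (by rw [h0]; exact hu) (by rw [h1]; exact hv) (by linarith)
  by_contra! hcon
  have hsub : Set.Icc s t ⊆ γ.I := by rw [hI]; exact Set.Icc_subset_Icc hs ht
  have := hC.abs_param_sub_le hC1 hst hsub fun r hr => by
    refine hcon _ ?_ (hmid r hr).1 (hmid r hr).2
    have hr' := hsub hr
    have e1 := γ.isGeodesic 0 (by rw [hI]; exact ⟨le_rfl, hd⟩) r hr'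
    have e2 := γ.isGeodesic r hr' _ (by rw [hI]; exact ⟨hd, le_rfl⟩)
    rw [h0, abs_of_nonpos (by linarith [hr.1])] at e1
    rw [h1, abs_of_nonpos (by linarith [hr.2])] at e2
    rw [mem_between, e1, e2]; ring
  rw [es, et, abs_of_nonpos (by linarith)] at this
  linarith

/-- A curtain with a large projection to a contracting geodesic `β` passes close to it, because any
two of its points are joined in it by a path of three geodesics. -/
theorem IsContracting.exists_close_of_curtain (hX : IsCAT0 X) {C : ℝ} (hC : β.IsContracting C)
    (hC1 : 1 ≤ C) {h : Curtain X} {a : ℝ} (hx : ∃ x ∈ h.carrier, β.param x ≤ a)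
    (hy : ∃ y ∈ h.carrier, a + 3 * (6 * C + 1) ≤ β.param y) :
    ∃ z ∈ h.carrier, a ≤ β.param z ∧ β.param z ≤ a + 3 * (6 * C + 1) ∧
      dist z (β.α (β.param z)) ≤ 2 * C := by
  obtain ⟨x, hx, hxa⟩ := hx
  obtain ⟨y, hy, hya⟩ := hy
  set η := h.toGeodesic
  have hperp : ∀ z ∈ h.carrier, between z (η.α (η.param z)) ⊆ h.carrier := by
    intro z hz w hw
    rw [mem_carrier _ hX] at hz ⊢
    rwa [coord, η.param_eq_of_mem_between hX hw]
  have hpole : between (η.α (η.param x)) (η.α (η.param y)) ⊆ h.carrier := by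
    intro w hw
    obtain ⟨r, hr, hrI, rfl⟩ :=
      η.exists_eq_of_mem_between hX (η.param_mem x) (η.param_mem y) hw
    rw [h.carrier_eq hX] at hx hy ⊢
    rw [Set.mem_preimage, coord, η.param_apply hX hrI]
    have := Set.uIcc_subset_Icc hx hy
    refine this ?_
    rw [Set.mem_uIcc] at hr ⊢
    exact hr.imp (fun H => ⟨sub_le_sub_right H.1 _, sub_le_sub_right H.2 _⟩)
      fun H => ⟨sub_le_sub_right H.1 _, sub_le_sub_right H.2 _⟩
  by_cases c1 : a + (6 * C + 1) ≤ β.param (η.α (η.param x))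
  · obtain ⟨z, hz, z1, z2, z3⟩ := hC.exists_close hX hC1 hxa c1
    exact ⟨z, hperp x hx hz, z1, by linarith, z3⟩
  push Not at c1
  by_cases c2 : a + (6 * C + 1) + (6 * C + 1) ≤ β.param (η.α (η.param y))
  · obtain ⟨z, hz, z1, z2, z3⟩ := hC.exists_close hX hC1 c1.le c2
    exact ⟨z, hpole hz, by linarith, by linarith, z3⟩
  push Not at c2
  obtain ⟨z, hz, z1, z2, z3⟩ := hC.exists_close hX hC1 (v := y) c2.le (by linarith)
  rw [between_comm] at hz
  exact ⟨z, hperp y hy hz, by linarith, by linarith, z3⟩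

/-- Contracting geodesics have bottlenecks: the curtains that cross a long piece of the geodesic
all meet a fixed bounded set, and a chain of curtains that meet a bounded set is short. -/
theorem IsContracting.exists_isBottleneck (hX : IsCAT0 X) {C : ℝ} (hC : β.IsContracting C)
    (hC1 : 1 ≤ C) : ∃ L W, 1 ≤ L ∧ 0 ≤ W ∧ ∀ a, β.IsBottleneck L a (a + W) := by
  refine ⟨⌈4 * C + 3 * (6 * C + 1)⌉₊ + 2, 3 * (6 * C + 1), by omega, by linarith,
    fun a n c hc hm => ?_⟩
  obtain ⟨c', ho, hc'⟩ := hc.exists_ordered hX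
  have hcar : ∀ i, (c' i).carrier = (c i).carrier := by
    intro i
    rcases hc' i with h | h <;> rw [h]
    exact carrier_flip hX
  have key : ∀ i, ∃ z ∈ (c' i).carrier, a ≤ β.param z ∧ β.param z ≤ a + 3 * (6 * C + 1) ∧
      dist z (β.α (β.param z)) ≤ 2 * C := by
    intro i
    rw [hcar]
    exact hC.exists_close_of_curtain hX hC1 (hm i).1 (hm i).2
  choose z hz z1 z2 z3 using key
  have hdist : ∀ i j, dist (z i) (z j) ≤ 4 * C + 3 * (6 * C + 1) := by
    intro i j
    have := dist_triangle4 (z i) (β.α (β.param (z i))) (β.α (β.param (z j))) (z j)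
    rw [β.isGeodesic _ (β.param_mem _) _ (β.param_mem _), dist_comm (β.α _) (z j)] at this
    have h2 : |β.param (z i) - β.param (z j)| ≤ 3 * (6 * C + 1) :=
      abs_le.2 ⟨by linarith [z1 i, z2 j], by linarith [z2 i, z1 j]⟩
    linarith [z3 i, z3 j]
  rcases n with _ | _ | n
  · omega
  · omega
  -- all members of the chain but the first and the last separate the points found on these two
  have hcard := IsOrdered.card_le_dist hX (c := fun i : Fin n => c' i.castSucc.succ)
    (ho.comp (Fin.strictMono_succ.comp Fin.strictMono_castSucc)) (x := z 0) (y := z (Fin.last _))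
    (fun i => (ho 0 _ (Fin.succ_pos _) (z 0) ((mem_carrier _ hX).1 (hz 0)).2).le)
    fun i => ((ho _ (Fin.last _) (by
      rw [Fin.succ_castSucc]; exact Fin.castSucc_lt_last _)).coord_gt
        ((mem_carrier _ hX).1 (hz (Fin.last _))).1).le
  have := hcard.trans ((hdist _ _).trans (Nat.le_ceil _))
  have : n ≤ ⌈4 * C + 3 * (6 * C + 1)⌉₊ := by exact_mod_cast this
  omega

end Geodesic

/-- Dual curtains of a line with bottlenecks that are spaced widely enough form `L`-chains. -/
theorem IsAxis.le_distL_of_isBottleneck (hX : IsCAT0 X) {g : X ≃ᵢ X} {β : Geodesic X} {τ : ℝ}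
    (h : IsAxis g β τ) {L : ℕ} {W : ℝ} (hW0 : 0 ≤ W) (hW : ∀ a, β.IsBottleneck L a (a + W))
    {N : ℕ} {t : ℝ} (ht : N * (W + 2) ≤ t) : (N : ℝ) ≤ distL L (β.α 0) (β.α t) := by
  rcases Nat.eq_zero_or_pos N with rfl | hN
  · simpa using distL_nonneg L _ _
  have hN' : (0 : ℝ) < N := by exact_mod_cast hN
  have hne : β.α 0 ≠ β.α t := by
    intro e
    have := h.dist_α 0 t
    rw [e, dist_self, zero_sub, abs_neg] at this
    have := abs_eq_zero.1 this.symm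
    nlinarith
  set k : Fin N → Curtain X := fun i => β.curtain ((i : ℕ) * (W + 2) + 1)
    (by rw [h.univ, interior_univ]; exact Set.subset_univ _)
  have hco : ∀ i x, (k i).coord x = β.param x - ((i : ℕ) * (W + 2) + 1) := fun i x => rfl
  have hlt : ∀ i j : Fin N, i < j →
      ((i : ℕ) : ℝ) * (W + 2) + (W + 2) ≤ (j : ℕ) * (W + 2) := by
    intro i j hij
    have : ((i : ℕ) : ℝ) + 1 ≤ (j : ℕ) := by exact_mod_cast hij
    nlinarith
  have hord : IsOrdered k := by
    intro i j hij z hz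
    rw [hco] at hz ⊢
    linarith [hlt i j hij]
  have hsep : ∀ i j, i < j → LSeparated L (k i) (k j) := by
    intro i j hij
    refine ⟨(hord i j hij).disjoint hX, fun n c hc hm => ?_⟩
    refine hW ((i : ℕ) * (W + 2) + 3 / 2) n c hc fun l => ⟨?_, ?_⟩
    · obtain ⟨x, hx, hx'⟩ := (hm l).1
      refine ⟨x, hx, ?_⟩
      have := ((mem_carrier _ hX).1 hx').2
      rw [hco] at this
      linarith
    · obtain ⟨x, hx, hx'⟩ := (hm l).2
      refine ⟨x, hx, ?_⟩
      have := ((mem_carrier _ hX).1 hx').1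
      rw [hco] at this
      linarith [hlt i j hij]
  have hchain : IsLChainFromTo L k (β.α 0) (β.α t) := by
    refine ⟨hord, fun i j hij => ?_, fun i => ?_, fun i => ?_⟩
    · rcases lt_or_gt_of_ne hij with h | h
      · exact hsep i j h
      · exact (hsep j i h).symm
    · rw [hco, β.param_apply hX (h.mem _)]
      have : (0 : ℝ) ≤ (i : ℕ) * (W + 2) := by positivity
      linarith
    · rw [hco, β.param_apply hX (h.mem _)]
      have : ((i : ℕ) : ℝ) + 1 ≤ N := by exact_mod_cast i.2
      nlinarith
  linarith [hchain.add_one_le_distL hX hne]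

/-- An isometry with an axis that has bottlenecks is loxodromic on `X_L`. -/
theorem IsAxis.isLoxodromic_distL (hX : IsCAT0 X) {g : X ≃ᵢ X} {β : Geodesic X} {τ : ℝ}
    (h : IsAxis g β τ) {L : ℕ} {W : ℝ} (hW0 : 0 ≤ W) (hW : ∀ a, β.IsBottleneck L a (a + W)) :
    IsLoxodromic (distL (X := X) L) g := by
  have hpos := h.pos
  have hW2 : 0 < W + 2 := by linarith
  refine (isInvariantDist_distL hX L).isLoxodromic_of_le (x := β.α 0) (a := τ / (W + 2)) (b := 1)
    (by positivity) fun n => ?_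
  have e : (g ^ n) (β.α 0) = β.α (n * τ) := by
    have := h.zpow_apply n 0
    rw [zpow_natCast, zero_add] at this
    exact_mod_cast this
  have h1 := Nat.floor_le (a := n * τ / (W + 2)) (by positivity)
  have h2 := Nat.lt_floor_add_one (n * τ / (W + 2))
  rw [le_div_iff₀ hW2] at h1
  have h3 := h.le_distL_of_isBottleneck hX hW0 hW h1
  rw [e, div_mul_eq_mul_div, mul_comm τ]
  linarith

/-! ### Contracting orbits and contracting axes -/

/-- Every point has a closest point on a discrete orbit along an axis. -/
theorem IsAxis.exists_closest_orbit {g : X ≃ᵢ X} {β : Geodesic X} {τ : ℝ} (h : IsAxis g β τ)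
    (x q : X) : (closestPoints (Set.range fun n : ℤ => (g ^ n) x) q).Nonempty := by
  have hpos := h.pos
  have hlim : Tendsto (fun k : ℤ => dist q ((g ^ k) x)) cofinite atTop := by
    have h1 : Tendsto (fun k : ℤ => ‖(k : ℝ)‖) cofinite atTop :=
      (tendsto_norm_cocompact_atTop (E := ℝ)).comp Int.tendsto_coe_cofinite
    have h2 := tendsto_atTop_add_const_right cofinite (-(dist q (β.α 0) + dist x (β.α 0)))
      (h1.atTop_mul_const hpos)
    refine tendsto_atTop_mono (fun k => ?_) h2
    have h3 := dist_triangle4 (β.α 0) q ((g ^ k) x) ((g ^ k) (β.α 0))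
    rw [(g ^ k).dist_eq, h.zpow_apply, h.dist_α,
      show (0 : ℝ) - (0 + k * τ) = -(k * τ) by ring, abs_neg, abs_mul, abs_of_pos hpos,
      dist_comm _ q] at h3
    rw [Real.norm_eq_abs]
    linarith
  obtain ⟨k, hk⟩ := hlim.exists_forall_le
  refine ⟨_, ⟨k, rfl⟩, ?_⟩
  rintro _ ⟨n, rfl⟩
  exact hk n

/-- If an orbit of an isometry is contracting, then so is its axis. The closest point projections
to the orbit and to the axis are a bounded distance apart: moving a point perpendicularly to the
axis until it is close to the axis changes the former only by a bounded amount. -/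
theorem IsAxis.exists_geodesic_isContracting (hX : IsCAT0 X) {g : X ≃ᵢ X} {β : Geodesic X} {τ : ℝ}
    (h : IsAxis g β τ) {x : X} {C : ℝ}
    (hC : IsContractingSet C (Set.range fun n : ℤ => (g ^ n) x)) :
    ∃ C', 1 ≤ C' ∧ β.IsContracting C' := by
  have hpos := h.pos
  set A := Set.range fun n : ℤ => (g ^ n) x with hA
  set R₀ := dist x (β.α 0) with hR₀
  have hR0 : 0 ≤ R₀ := dist_nonneg
  set R := R₀ + τ with hR
  have hCabs := le_abs_self C
  have hCnn := abs_nonneg C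
  have horb : ∀ k : ℤ, dist ((g ^ k) x) (β.α (k * τ)) = R₀ := by
    intro k
    have := (g ^ k).dist_eq x (β.α 0)
    rwa [h.zpow_apply, zero_add] at this
  have hnear : ∀ t, ∃ a ∈ A, dist (β.α t) a ≤ R := by
    intro t
    refine ⟨_, ⟨⌊t / τ⌋, rfl⟩, ?_⟩
    have h1 := dist_triangle (β.α t) (β.α (⌊t / τ⌋ * τ)) ((g ^ ⌊t / τ⌋) x)
    have h2 := (le_div_iff₀ hpos).1 (Int.floor_le (t / τ))
    have h3 := (div_lt_iff₀ hpos).1 (Int.lt_floor_add_one (t / τ))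
    rw [dist_comm (β.α (⌊t / τ⌋ * τ)), horb, h.dist_α, abs_of_nonneg (by linarith)] at h1
    change dist (β.α t) ((g ^ ⌊t / τ⌋) x) ≤ R
    linarith
  have hball : ∀ (y : X) (ρ : ℝ), ρ ≤ dist y (β.α (β.param y)) - R₀ →
      Disjoint (Metric.ball y ρ) A := by
    intro y ρ hρ
    rw [Set.disjoint_right]
    rintro _ ⟨k, rfl⟩ hk
    rw [Metric.mem_ball, dist_comm] at hk
    have h1 := dist_triangle y ((g ^ k) x) (β.α (k * τ))
    have h2 := β.dist_param_le y (h.mem (k * τ))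
    rw [horb] at h1
    linarith
  have hproj : ∀ y, ∀ a ∈ closestPoints A y,
      dist a (β.α (β.param y)) ≤ |C| + 3 * R + 2 := by
    intro y a ha
    have hclose : ∀ q, β.param q = β.param y → dist q (β.α (β.param q)) ≤ R + 1 →
        ∀ a' ∈ closestPoints A q, dist a' (β.α (β.param y)) ≤ 3 * R + 2 := by
      intro q hq hqR a' ha'
      obtain ⟨b, hb, hbR⟩ := hnear (β.param q)
      have h1 := ha'.2 b hb
      have h2 := dist_triangle q (β.α (β.param q)) b
      have h3 := dist_triangle a' q (β.α (β.param q))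
      rw [dist_comm a' q] at h3
      rw [← hq]
      linarith
    rcases le_total (dist y (β.α (β.param y))) (R + 1) with hle | hle
    · linarith [hclose y rfl hle a ha]
    · obtain ⟨q, hq, e⟩ := hX.exists_mem_between (f := fun z => dist y z)
        (continuous_const.dist continuous_id) (x := y) (y := β.α (β.param y))
        (c := dist y (β.α (β.param y)) - (R + 1)) (by rw [dist_self]; linarith) (by linarith)
      have hqp := β.param_eq_of_mem_between hX hq
      rw [mem_between] at hq
      obtain ⟨a', ha'⟩ := h.exists_closest_orbit x q
      have h1 := hC y (dist y (β.α (β.param y)) - R₀) (hball y _ le_rfl) y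
        (Metric.mem_ball_self (by linarith)) q
        (by rw [Metric.mem_ball, dist_comm, e]; linarith) a ha a' ha'
      have h2 := hclose q hqp (by rw [hqp]; linarith) a' ha'
      linarith [dist_triangle a a' (β.α (β.param y))]
  refine ⟨3 * |C| + 7 * R + 5, by linarith, fun p q hpq => ?_⟩
  rcases le_total (dist p (β.α (β.param p))) (R + 1) with hle | hle
  · linarith [β.abs_param_sub_le hX p q]
  obtain ⟨q', hq', hd, hd'⟩ : ∃ q' ∈ between p q,
      dist p q' ≤ dist p (β.α (β.param p)) - (R + 1) ∧ dist q' q ≤ R + 1 := by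
    rcases le_total (dist p q) (dist p (β.α (β.param p)) - (R + 1)) with h1 | h1
    · exact ⟨q, right_mem_between _ _, h1, by rw [dist_self]; linarith⟩
    · obtain ⟨q', hq', e⟩ := hX.exists_mem_between (f := fun z => dist p z)
        (continuous_const.dist continuous_id) (x := p) (y := q)
        (c := dist p (β.α (β.param p)) - (R + 1)) (by rw [dist_self]; linarith) h1
      refine ⟨q', hq', e.le, ?_⟩
      rw [mem_between] at hq'
      linarith
  obtain ⟨a, ha⟩ := h.exists_closest_orbit x p
  obtain ⟨a', ha'⟩ := h.exists_closest_orbit x q'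
  have h1 := hC p (dist p (β.α (β.param p)) - R₀) (hball p _ le_rfl) p
    (Metric.mem_ball_self (by linarith)) q'
    (by rw [Metric.mem_ball, dist_comm]; linarith) a ha a' ha'
  have h2 := hproj p a ha
  have h3 := hproj q' a' ha'
  have h4 := dist_triangle4 (β.α (β.param p)) a a' (β.α (β.param q'))
  rw [h.dist_α, dist_comm _ a] at h4
  have h5 := β.abs_param_sub_le hX q' q
  have h6 := abs_sub_le (β.param p) (β.param q') (β.param q)
  linarith

/-! ### Axes of semisimple isometries -/

/-- The translates of a geodesic from `x` to `g x` form an axis if `g` moves `x` by its translation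
length. -/
theorem exists_isAxis (hX : IsCAT0 X) {g : X ≃ᵢ X} {τ : ℝ} (hτ : 0 < τ)
    (ht : IsTranslationLength dist g τ) {x : X} (hx : dist x (g x) = τ) :
    ∃ β : Geodesic X, IsAxis g β τ := by
  obtain ⟨γ, h0, h1, hγ⟩ := hX.exists_geodesic x (g x)
  rw [hx] at h1 hγ
  have hnat : ∀ k : ℕ, dist x ((g ^ k) x) = k * τ := by
    intro k
    refine le_antisymm ?_ (isInvariantDist_dist.mul_le_of_isTranslationLength ht x k)
    induction k with
    | zero => simp
    | succ k ih =>
      have := dist_triangle x ((g ^ k) x) ((g ^ (k + 1)) x)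
      rw [pow_succ, IsometryEquiv.mul_apply, (g ^ k).dist_eq, hx] at this
      rw [pow_succ, IsometryEquiv.mul_apply]
      push_cast
      linarith
  have hint : ∀ m n : ℤ, m ≤ n → dist ((g ^ m) x) ((g ^ n) x) = (n - m) * τ := by
    intro m n hmn
    obtain ⟨k, rfl⟩ := Int.le.dest hmn
    rw [zpow_add, IsometryEquiv.mul_apply, (g ^ m).dist_eq, zpow_natCast, hnat]
    push_cast; ring
  set fl : ℝ → ℤ := fun t => ⌊t / τ⌋ with hfl
  have fl1 : ∀ t, fl t * τ ≤ t := fun t => (le_div_iff₀ hτ).1 (Int.floor_le (t / τ))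
  have fl2 : ∀ t, t < (fl t + 1) * τ := fun t =>
    (div_lt_iff₀ hτ).1 (Int.lt_floor_add_one (t / τ))
  set α : ℝ → X := fun t => (g ^ fl t) (γ (t - fl t * τ)) with hα
  have hmem : ∀ t, t - fl t * τ ∈ Set.Icc 0 τ := fun t =>
    ⟨by linarith [fl1 t], by linarith [fl2 t]⟩
  have hl : ∀ t, dist ((g ^ fl t) x) (α t) = t - fl t * τ := by
    intro t
    rw [hα]
    change dist _ ((g ^ fl t) _) = _
    rw [(g ^ fl t).dist_eq, ← h0, hγ 0 ⟨le_rfl, hτ.le⟩ _ (hmem t), zero_sub, abs_neg,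
      abs_of_nonneg (hmem t).1]
  have hr : ∀ t, dist (α t) ((g ^ (fl t + 1)) x) = (fl t + 1) * τ - t := by
    intro t
    rw [hα, zpow_add_one, IsometryEquiv.mul_apply]
    change dist ((g ^ fl t) _) _ = _
    rw [(g ^ fl t).dist_eq, ← h1, hγ _ (hmem t) _ ⟨hτ.le, le_rfl⟩,
      abs_of_nonpos (by linarith [(hmem t).2])]
    ring
  have hiso : ∀ s t, s ≤ t → dist (α s) (α t) = t - s := by
    intro s t hst
    have hle : fl s ≤ fl t := Int.floor_le_floor (div_le_div_of_nonneg_right hst hτ.le)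
    refine le_antisymm ?_ ?_
    · rcases hle.eq_or_lt with e | hlt
      · have h2 := hmem s
        rw [hα]
        change dist ((g ^ fl s) _) ((g ^ fl t) _) ≤ _
        rw [e] at h2 ⊢
        rw [(g ^ fl t).dist_eq, hγ _ h2 _ (hmem t), abs_of_nonpos (by linarith)]
        linarith
      · have h2 := dist_triangle4 (α s) ((g ^ (fl s + 1)) x) ((g ^ fl t) x) (α t)
        rw [hr, hl, hint _ _ hlt] at h2
        push_cast at h2
        linarith
    · have h2 := dist_triangle4 ((g ^ fl s) x) (α s) (α t) ((g ^ (fl t + 1)) x)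
      rw [hr, hl, hint _ _ (by omega)] at h2
      push_cast at h2
      linarith
  refine ⟨⟨Set.univ, α, Set.univ_nonempty, Set.ordConnected_univ, isClosed_univ,
    fun s _ t _ => ?_⟩, hτ, rfl, fun t => ?_⟩
  · rcases le_total s t with hst | hst
    · rw [hiso s t hst, abs_of_nonpos (by linarith)]; ring
    · rw [dist_comm, hiso t s hst, abs_of_nonneg (by linarith)]
  · have e : fl (t + τ) = fl t + 1 := by
      simp only [hfl]
      rw [add_div, div_self hτ.ne', Int.floor_add_one]
    change g ((g ^ fl t) _) = (g ^ fl (t + τ)) (γ (t + τ - fl (t + τ) * τ))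
    rw [e, add_comm (fl t) 1, zpow_one_add, IsometryEquiv.mul_apply]
    push_cast
    ring_nf

/-- A contracting isometry has positive translation length. -/
theorem IsContracting.translationLength_pos {g : X ≃ᵢ X} (hg : IsContracting g) {t : ℝ}
    (ht : IsTranslationLength dist g t) : 0 < t := by
  obtain ⟨x, ⟨K, c, hK, hc, hqi⟩, -⟩ := hg
  have hK0 : 0 < K := by linarith
  obtain ⟨t', ht', h⟩ := isInvariantDist_dist.isLoxodromic_of_le (g := g) (x := x) (a := 1 / K)
    (b := c) (by positivity) fun n => by
      have := (hqi 0 n).1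
      simp only [Int.cast_zero, zero_sub, abs_neg, Int.cast_natCast, Nat.abs_cast, zpow_zero,
        zpow_natCast] at this
      rw [one_div_mul_eq_div]
      exact this
  rwa [tendsto_nhds_unique (ht x) (h x)]

theorem IsContracting.exists_isLoxodromic_distL (hX : IsCAT0 X) {g : X ≃ᵢ X}
    (hs : IsSemisimple g) (hg : IsContracting g) :
    ∃ L : ℕ+, IsLoxodromic (distL (X := X) (L : ℕ)) g := by
  obtain ⟨τ, ht, x, hx⟩ := hs
  obtain ⟨β, h⟩ := exists_isAxis hX (hg.translationLength_pos ht) ht hx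
  obtain ⟨y, -, C, hC⟩ := hg
  obtain ⟨C', hC1, hC'⟩ := h.exists_geodesic_isContracting hX hC
  obtain ⟨L, W, hL, hW0, hW⟩ := hC'.exists_isBottleneck hX hC1
  exact ⟨⟨L, hL⟩, h.isLoxodromic_distL hX hW0 hW⟩

theorem IsLoxodromic.distD_of_distL (hX : IsCAT0 X) {w : ℕ+ → ℝ} (hw : IsCurtainWeight w)
    {g : X ≃ᵢ X} (x : X) {L : ℕ+} (h : IsLoxodromic (distL (X := X) (L : ℕ)) g) :
    IsLoxodromic (distD (X := X) w) g := by
  obtain ⟨t, ht0, ht⟩ := h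
  have hwL := (hw.mem_Ioo L).1
  refine (isInvariantDist_distD hX hw).isLoxodromic_of_le (x := x) (a := w L * t) (b := 0)
    (by positivity) fun n => ?_
  have h1 := (isInvariantDist_distL hX L).mul_le_of_isTranslationLength ht x n
  have h2 := mul_distL_le_distD hX hw L x ((g ^ n) x)
  nlinarith

theorem IsSemisimple.isElliptic_distD (hX : IsCAT0 X) {w : ℕ+ → ℝ} (hw : IsCurtainWeight w)
    {g : X ≃ᵢ X} (hs : IsSemisimple g) (hg : ¬ IsContracting g) :
    IsElliptic (distD (X := X) w) g := by
  obtain ⟨τ, ht, x, hx⟩ := hs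
  have hd := isInvariantDist_distD hX hw
  rcases (hx ▸ dist_nonneg : 0 ≤ τ).eq_or_lt with rfl | hτ
  · -- an isometry of translation length zero that attains it has a fixed point
    have hfix : ∀ n : ℤ, (g ^ n) x = x := by
      have hgx : g x = x := (dist_eq_zero.1 hx).symm
      have hginv : (g⁻¹ : X ≃ᵢ X) x = x := by
        apply g.injective
        rw [← IsometryEquiv.mul_apply, mul_inv_cancel, hgx]; rfl
      intro n
      induction n with
      | zero => simp
      | succ n ih => rw [zpow_add_one, IsometryEquiv.mul_apply, hgx, ih]
      | pred n ih => rw [zpow_sub_one, IsometryEquiv.mul_apply, hginv, ih]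
    exact hd.isElliptic_of_orbitBounded (x := x) ⟨0, fun m n => by rw [hfix, hfix, hd.self]⟩
  · obtain ⟨β, h⟩ := exists_isAxis hX hτ ht hx
    exact hd.isElliptic_of_orbitBounded (h.orbitBounded_distD hX hw hg)

end CurtainModel

theorem mainTheorem5 {X : Type*} [MetricSpace X] (hX : CurtainModel.IsCAT0 X)
    (w : ℕ+ → ℝ) (hw : CurtainModel.IsCurtainWeight w)
    (g : X ≃ᵢ X) (hg : CurtainModel.IsSemisimple g) :
    [CurtainModel.IsContracting g,
      ∃ L : ℕ+, CurtainModel.IsLoxodromic (CurtainModel.distL (X := X) (L : ℕ)) g,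
      CurtainModel.IsLoxodromic (CurtainModel.distD (X := X) w) g].TFAE ∧
    ¬ CurtainModel.IsParabolic (CurtainModel.distD (X := X) w) g ∧
    (CurtainModel.IsLoxodromic (CurtainModel.distD (X := X) w) g ↔
      CurtainModel.IsContracting g) ∧
    (¬ CurtainModel.IsContracting g →
      CurtainModel.IsElliptic (CurtainModel.distD (X := X) w) g) := by
  obtain ⟨x⟩ : Nonempty X := hg.elim fun _ h => h.2.elim fun x _ => ⟨x⟩
  have h12 := CurtainModel.IsContracting.exists_isLoxodromic_distL hX hg
  have h23 : (∃ L : ℕ+, CurtainModel.IsLoxodromic (CurtainModel.distL (X := X) (L : ℕ)) g) →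
      CurtainModel.IsLoxodromic (CurtainModel.distD (X := X) w) g :=
    fun ⟨_, hL⟩ => hL.distD_of_distL hX hw x
  have hell := hg.isElliptic_distD hX hw
  have h31 : CurtainModel.IsLoxodromic (CurtainModel.distD (X := X) w) g →
      CurtainModel.IsContracting g := fun h => by
    by_contra hc
    exact h.not_isElliptic x (hell hc)
  refine ⟨?_, ?_, ⟨h31, fun h => h23 (h12 h)⟩, hell⟩
  · tfae_have 1 → 2 := h12
    tfae_have 2 → 3 := h23
    tfae_have 3 → 1 := h31
    tfae_finish
  · by_cases hc : CurtainModel.IsContracting g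
    · exact (h23 (h12 hc)).not_isParabolic x
    · exact (hell hc).not_isParabolic
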